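/- Notation and conventions. An ice quiver $Q$ is a finite quiver without loops or directed 2-cycles, on a finite vertex set $N$, $|N|=n$, with a distinguished set of frozen vertices; the other vertices are called mutable. It is recorded by the skew-symmetric integer matrix $Q_{ij}=\#\{\text{arrows } i\to j\}-\#\{\text{arrows } j\to i\}$. A seed $(Q,\mathbf a)$ is an ice quiver $Q$ with a family (the cluster) $\mathbf a=(a_i)_{i\in N}$ of elements of $\mathbb{Q}(x_1,\dots,x_n)$. Its mutation at a mutable vertex $k$ is the seed whose quiver has the same frozen vertices and the matrix $$\mu_k(Q)_{ij}=\begin{cases}-Q_{ij}& k\in\{i,j\},\\ Q_{ij}+\tfrac12\left(|Q_{ik}|Q_{kj}+Q_{ik}|Q_{kj}|\right)&\text{otherwise,}\end{cases}$$ and whose cluster is obtained by replacing $a_k$ with $a_k^{-1}\left(\prod_{Q_{kj}>0}a_j^{Q_{kj}}+\prod_{Q_{kj}<0}a_j^{-Q_{kj}}\right)$. Two seeds are mutation equivalent if they are related by finitely many mutations. The cluster algebra $\mathcal A=\mathcal A(Q,\mathbf a)$ is the subring of $\mathbb{Q}(x_1,\dots,x_n)$ generated by all elements of all clusters of seeds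 mutation equivalent to $(Q,\mathbf a)$ together with the inverses of the $a_i$ for $i$ frozen; these seeds are called the seeds of $\mathcal A$. It is acyclic if it has a seed whose induced subquiver on the mutable vertices has no directed cycle. A freezing of $\mathcal A$ is the cluster algebra $\mathcal A'$ of a seed obtained from a seed of $\mathcal A$ by declaring some further vertices frozen. It is a cluster localization of $\mathcal A$ if $\mathcal A\subseteq\mathcal A'$; the image of $\operatorname{Spec}\mathcal A'$ in $\operatorname{Spec}\mathcal A$ is then called a cluster chart, acyclic if $\mathcal A'$ is acyclic. $\mathcal A$ is locally acyclic if $\operatorname{Spec}\mathcal A$ is covered by finitely many acyclic cluster charts. The exchange matrix of $Q$ is the matrix $(Q_{ij})$ with rows indexed by the mutable vertices $i$ and columns indexed by all vertices $j$; it has full rank if it is surjective as a $\mathbb{Q}$-linear map. A ring is regular if it is Noetherian and its localization at every prime ideal is a regular local ring. Theorem. Let $(Q,\mathbf a)$ be a seed such that the elements $a_i$, $i\in N$, are algebraically independent over $\mathbb{Q}$ (for example the initial seed, $a_i=x_i$). If the cluster algebra $\mathcal A=\mathcal A(Q,\mathbf a)$ is locally acyclic and the exchange matrix of $Q$ has full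 rank, then $\mathbb{Q}\otimes_{\mathbb{Z}}\mathcal A$ is a regular ring. -/

import Mathlib

open scoped TensorProduct

/-- An ice quiver on the vertex set `N`, without loops or directed 2-cycles, recorded by its
skew-symmetric matrix: `B i j` is the number of arrows from `i` to `j` minus the number of arrows
from `j` to `i`. Vertices outside `frozen` are mutable. -/
@[ext]
structure IceQuiver (N : Type*) where
  B : Matrix N N ℤ
  skew : ∀ i j, B i j = -B j i
  frozen : Finset N

namespace IceQuiver

/-- The correction term in matrix mutation is an integer: its numerator is even. -/
theorem two_dvd_mutation_term (a b : ℤ) : 2 ∣ |a| * b + a * |b| := by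
  rcases abs_cases a with ⟨ha, _⟩ | ⟨ha, _⟩ <;> rcases abs_cases b with ⟨hb, _⟩ | ⟨hb, _⟩ <;>
    rw [ha, hb]
  · exact ⟨a * b, by ring⟩
  · exact ⟨0, by ring⟩
  · exact ⟨0, by ring⟩
  · exact ⟨-(a * b), by ring⟩

/-- Mutation of an ice quiver at `k` (used only for mutable `k`). The division by 2 is exact. -/
def mutate {N : Type*} [DecidableEq N] (Q : IceQuiver N) (k : N) : IceQuiver N where
  B := fun i j =>
    if k = i ∨ k = j then -Q.B i j
    else Q.B i j + (|Q.B i k| * Q.B k j + Q.B i k * |Q.B k j|) / 2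
  skew := by
    intro i j
    by_cases h : k = i ∨ k = j
    · rw [if_pos h, if_pos h.symm, Q.skew i j]
    · rw [if_neg h, if_neg fun h' => h h'.symm]
      have e : |Q.B j k| * Q.B k i + Q.B j k * |Q.B k i|
          = -(|Q.B i k| * Q.B k j + Q.B i k * |Q.B k j|) := by
        rw [Q.skew j k, Q.skew k i, abs_neg, abs_neg]; ring
      rw [e, Int.neg_ediv_of_dvd (two_dvd_mutation_term _ _), Q.skew i j]; ring
  frozen := Q.frozen

/-- Declare the vertices in `S` to be frozen as well. -/
def freeze {N : Type*} [DecidableEq N] (Q : IceQuiver N) (S : Finset N) : IceQuiver N where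
  B := Q.B
  skew := Q.skew
  frozen := Q.frozen ∪ S

/-- There is an arrow from `i` to `j` in the induced subquiver on the mutable vertices. -/
def MutableArrow {N : Type*} (Q : IceQuiver N) (i j : N) : Prop :=
  i ∉ Q.frozen ∧ j ∉ Q.frozen ∧ 0 < Q.B i j

/-- The induced subquiver on the mutable vertices has no directed cycles. -/
def IsAcyclic {N : Type*} (Q : IceQuiver N) : Prop :=
  ∀ i, ¬ Relation.TransGen Q.MutableArrow i i

/-- The exchange matrix: one row for each mutable vertex, one column for each vertex. -/
def exchangeMatrix {N : Type*} (Q : IceQuiver N) : Matrix {i : N // i ∉ Q.frozen} N ℤ :=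
  Matrix.of fun i j => Q.B i j

/-- The exchange matrix is surjective as a `ℚ`-linear map. -/
def HasFullRank {N : Type*} [Fintype N] (Q : IceQuiver N) : Prop :=
  Function.Surjective (Q.exchangeMatrix.map (Int.cast : ℤ → ℚ)).mulVecLin

end IceQuiver

/-- The field `ℚ(x_i : i ∈ N)` of rational functions. -/
abbrev RatFunField (N : Type*) : Type _ := FractionRing (MvPolynomial N ℚ)

/-- A seed: an ice quiver with a rational function attached to each vertex. -/
@[ext]
structure ClusterSeed (N : Type*) where
  quiver : IceQuiver N
  cluster : N → RatFunField N

namespace ClusterSeed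

/-- The initial seed of an ice quiver, with cluster variables `x_i`. -/
noncomputable def initial {N : Type*} (Q : IceQuiver N) : ClusterSeed N where
  quiver := Q
  cluster := fun i => algebraMap (MvPolynomial N ℚ) (RatFunField N) (MvPolynomial.X i)

/-- Mutation of a seed at `k` (used only for mutable `k`). In the first product only the factors
with `0 < B k j` differ from `1`, in the second only those with `B k j < 0`. -/
noncomputable def mutate {N : Type*} [Fintype N] [DecidableEq N]
    (s : ClusterSeed N) (k : N) : ClusterSeed N where
  quiver := s.quiver.mutate k
  cluster := fun i =>
    if i = k then
      (∏ j, s.cluster j ^ (s.quiver.B k j).toNat + ∏ j, s.cluster j ^ (-s.quiver.B k j).toNat)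
        * (s.cluster k)⁻¹
    else s.cluster i

/-- Declare the vertices in `S` to be frozen, without changing the cluster. -/
noncomputable def freeze {N : Type*} [DecidableEq N]
    (s : ClusterSeed N) (S : Finset N) : ClusterSeed N where
  quiver := s.quiver.freeze S
  cluster := s.cluster

/-- `t` is obtained from `s` by a finite sequence of mutations at mutable vertices. -/
def MutationEquiv {N : Type*} [Fintype N] [DecidableEq N] (s t : ClusterSeed N) : Prop :=
  Relation.ReflTransGen
    (fun u v : ClusterSeed N => ∃ k, k ∉ u.quiver.frozen ∧ v = u.mutate k) s t

/-- All elements (mutable or frozen) of all clusters mutation equivalent to the given one. -/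
def clusterVariables {N : Type*} [Fintype N] [DecidableEq N] (s : ClusterSeed N) :
    Set (RatFunField N) :=
  {f | ∃ t, s.MutationEquiv t ∧ ∃ i, f = t.cluster i}

/-- The cluster algebra over `ℤ`: generated by the cluster variables and the inverses of the
frozen variables (which are not changed by mutation). -/
noncomputable def clusterAlgebra {N : Type*} [Fintype N] [DecidableEq N] (s : ClusterSeed N) :
    Subring (RatFunField N) :=
  Subring.closure (s.clusterVariables ∪ {f | ∃ i ∈ s.quiver.frozen, f = (s.cluster i)⁻¹})

/-- The cluster algebra of `s` is acyclic: it has an acyclic seed. -/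
def HasAcyclicSeed {N : Type*} [Fintype N] [DecidableEq N] (s : ClusterSeed N) : Prop :=
  ∃ t, s.MutationEquiv t ∧ t.quiver.IsAcyclic

/-- `t` is a freezing of some seed of the cluster algebra of `s`. -/
def IsFreezing {N : Type*} [Fintype N] [DecidableEq N] (s t : ClusterSeed N) : Prop :=
  ∃ u, s.MutationEquiv u ∧ ∃ S : Finset N, t = u.freeze S

/-- The cluster algebra of `t` is a cluster localization of the cluster algebra of `s`: it is a
freezing which contains the cluster algebra of `s`. -/
def IsClusterLocalization {N : Type*} [Fintype N] [DecidableEq N] (s t : ClusterSeed N) : Prop :=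
  s.IsFreezing t ∧ s.clusterAlgebra ≤ t.clusterAlgebra

/-- The image of `Spec` of the cluster algebra of `t` in `Spec` of the cluster algebra of `s`,
for a cluster localization `t`. -/
def clusterChart {N : Type*} [Fintype N] [DecidableEq N] {s t : ClusterSeed N}
    (h : s.IsClusterLocalization t) : Set (PrimeSpectrum s.clusterAlgebra) :=
  Set.range (PrimeSpectrum.comap (Subring.inclusion h.2))

/-- `Spec` of the cluster algebra has a finite cover by acyclic cluster charts. -/
def IsLocallyAcyclic {N : Type*} [Fintype N] [DecidableEq N] (s : ClusterSeed N) : Prop :=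
  ∃ T : Set (ClusterSeed N), T.Finite ∧
    (∀ t ∈ T, s.IsClusterLocalization t ∧ t.HasAcyclicSeed) ∧
    ∀ P : PrimeSpectrum s.clusterAlgebra,
      ∃ t ∈ T, ∃ h : s.IsClusterLocalization t, P ∈ clusterChart h

end ClusterSeed

/-! ### Regular rings: localization, covers, unramified extensions -/

/-! Full rank makes the mutable rows of the exchange matrix linearly independent. Together with
algebraic independence of the cluster (`ClusterSeed.IsNondegenerate`) this survives mutation and
freezing. Two independent rows are separated by a grading, so the binomials `1 + x ^ v`, `1 + x ^ w`
of distinct mutable vertices are coprime in Laurent rings. Coprimality makes the upper algebra of a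
seed invariant under mutation (`IsNondegenerate.upperAlgebra_le_mutate`), which yields the Laurent
phenomenon.

In an acyclic seed, an arrow i → j into a mutable sink gives an exchange relation x_j x_j' = unit +
x_i(...), so x_i and x_j generate the unit ideal of the lower algebra. Freezing a vertex inverts its
variable. Induction on the number of mutable vertices therefore reduces both regularity of the lower
algebra and its containing the upper one to seeds without arrows between mutable vertices
(`IsNondegenerate.upperAlgebra_le_and_isRegularRing`). For these, row independence provides
polynomial coordinates such that, after inverting some of their polynomials, every frozen variable
is a root of a unit; in characteristic zero adjoining such roots is unramified and preserves
regularity (`IsNondegenerate.isRegularRing_of_isIsolated`).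

Over ℚ the cluster algebra lies between the lower and upper algebras of an acyclic seed, hence
equals both. In the locally acyclic case each chart is the principal open set of a product of
cluster variables; these products generate the unit ideal, and regularity is local. -/

theorem IsRegularRing.of_isLocalization {R A : Type*} [CommRing R] [CommRing A] [Algebra R A]
    (M : Submonoid R) [IsLocalization M A] [IsRegularRing R] : IsRegularRing A := by
  have := IsLocalization.isNoetherianRing M A inferInstance
  rw [isRegularRing_iff]
  intro p hp
  have : IsLocalization.AtPrime (Localization.AtPrime p) (p.under R) :=
    IsLocalization.isLocalization_isLocalization_atPrime_isLocalization M
      (Localization.AtPrime p) p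
  exact IsRegularLocalRing.of_ringEquiv (IsLocalization.algEquiv (p.under R).primeCompl
    (Localization.AtPrime (p.under R)) (Localization.AtPrime p)).toRingEquiv

theorem isRegularRing_of_away {R : Type*} [CommRing R] (s : Set R) (hs : Ideal.span s = ⊤)
    (h : ∀ f ∈ s, IsRegularRing (Localization.Away f)) : IsRegularRing R := by
  obtain ⟨t, hts, ht⟩ := (Ideal.span_eq_top_iff_finite s).mp hs
  have : IsNoetherianRing R :=
    AlgebraicGeometry.isNoetherianRing_of_away t ht fun f => by
      have := h f (hts f.2)
      infer_instance
  rw [isRegularRing_iff]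
  intro p hp
  obtain ⟨f, hf, hfp⟩ : ∃ f ∈ t, f ∉ p := by
    by_contra! hc
    exact hp.ne_top (top_le_iff.mp (ht ▸ Ideal.span_le.mpr hc))
  have hdisj : Disjoint (Submonoid.powers f : Set R) (p : Set R) := by
    rw [Set.disjoint_left]
    rintro _ ⟨n, rfl⟩ hn
    exact hfp (hp.mem_of_pow_mem n hn)
  let q := p.map (algebraMap R (Localization.Away f))
  have hq : q.IsPrime :=
    IsLocalization.isPrime_of_isPrime_disjoint (Submonoid.powers f) _ p hp hdisj
  have hqp : q.under R = p :=
    IsLocalization.under_map_of_isPrime_disjoint (Submonoid.powers f) _ hp hdisj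
  have : IsRegularRing (Localization.Away f) := h f (hts hf)
  have : IsLocalization.AtPrime (Localization.AtPrime q) p := by
    convert IsLocalization.isLocalization_isLocalization_atPrime_isLocalization
      (Submonoid.powers f) (Localization.AtPrime q) q
    exact hqp.symm
  exact IsRegularLocalRing.of_ringEquiv (IsLocalization.algEquiv p.primeCompl
    (Localization.AtPrime q) (Localization.AtPrime p)).toRingEquiv

/-- By unramifiedness the maximal ideal at P is extended from p = P ∩ R, so it needs at most ht p
generators. Going down, available because R is integrally closed and S is an integral domain
extension, gives ht p ≤ ht P. Hence the generators number at most the dimension. -/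
theorem isRegularRing_of_unramified {R S : Type*} [CommRing R] [CommRing S] [Algebra R S]
    [IsDomain S] [FaithfulSMul R S] [Algebra.IsIntegral R S] [IsIntegrallyClosed R]
    [IsRegularRing R] [Algebra.FiniteType R S] [Algebra.FormallyUnramified R S] :
    IsRegularRing S := by
  have : IsNoetherianRing S := Algebra.FiniteType.isNoetherianRing R S
  rw [isRegularRing_iff]
  intro P hP
  let p := P.under R
  have : P.LiesOver p := ⟨rfl⟩
  have hreg : IsRegularLocalRing (Localization.AtPrime p) := inferInstance
  let _ : Algebra (Localization.AtPrime p) (Localization.AtPrime P) :=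
    Localization.AtPrime.algebraOfLiesOver p P
  have hmax : (IsLocalRing.maximalIdeal (Localization.AtPrime p)).map
      (algebraMap (Localization.AtPrime p) (Localization.AtPrime P)) =
      IsLocalRing.maximalIdeal (Localization.AtPrime P) := by
    have : Algebra.FormallyUnramified S (Localization.AtPrime P) :=
      .of_isLocalization P.primeCompl
    have : Algebra.FormallyUnramified R (Localization.AtPrime P) := .comp R S _
    have : Algebra.FormallyUnramified (Localization.AtPrime p) (Localization.AtPrime P) :=
      .of_restrictScalars R _ _
    have : Algebra.EssFiniteType S (Localization.AtPrime P) := .of_isLocalization _ P.primeCompl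
    have : Algebra.EssFiniteType R (Localization.AtPrime P) := .comp R S _
    have : Algebra.EssFiniteType (Localization.AtPrime p) (Localization.AtPrime P) :=
      .of_comp R _ _
    exact Algebra.FormallyUnramified.map_maximalIdeal
  apply IsRegularLocalRing.of_spanFinrank_maximalIdeal_le
  have h1 : (IsLocalRing.maximalIdeal (Localization.AtPrime P)).spanFinrank ≤
      (IsLocalRing.maximalIdeal (Localization.AtPrime p)).spanFinrank := by
    rw [← hmax]
    exact Ideal.spanFinrank_map_le_of_fg _
      (IsLocalRing.maximalIdeal (Localization.AtPrime p)).fg_of_isNoetherianRing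
  have h2 : p.height ≤ P.height := by
    rw [Ideal.height_eq_height_add_of_liesOver_of_hasGoingDown p P]
    exact le_self_add
  have h3 := (isRegularLocalRing_iff _).mp hreg
  rw [IsLocalization.AtPrime.ringKrullDim_eq_height p] at h3
  rw [IsLocalization.AtPrime.ringKrullDim_eq_height P]
  calc ((IsLocalRing.maximalIdeal (Localization.AtPrime P)).spanFinrank : WithBot ℕ∞)
      ≤ (IsLocalRing.maximalIdeal (Localization.AtPrime p)).spanFinrank := by exact_mod_cast h1
    _ = p.height := h3
    _ ≤ P.height := by exact_mod_cast h2

/-! ### Localization and coprimality for subalgebras of a fixed field -/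

namespace Subalgebra

variable {k K : Type*} [Field k] [Field K] [Algebra k K]

/-- Inside one field a localization can be recognized elementwise, so all later localizations are
plain subalgebras compared by inclusion. -/
theorem isLocalization_away_inclusion {A B : Subalgebra k K} (hAB : A ≤ B) (f : A)
    (hf0 : (f : K) ≠ 0) (hf : (f : K)⁻¹ ∈ B) (hB : ∀ b ∈ B, ∃ n : ℕ, (f : K) ^ n * b ∈ A) :
    letI := (inclusion hAB).toAlgebra
    IsLocalization.Away f B := by
  let _ := (inclusion hAB).toAlgebra
  have hmap : ∀ a : A, ((algebraMap A B a : B) : K) = a := fun _ => rfl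
  refine ⟨?_, ?_, ?_⟩
  · rintro ⟨_, n, rfl⟩
    rw [map_pow]
    refine IsUnit.pow n (IsUnit.of_mul_eq_one ⟨_, hf⟩ (Subtype.ext ?_))
    simp [hmap, hf0]
  · rintro ⟨b, hb⟩
    obtain ⟨n, hn⟩ := hB b hb
    refine ⟨(⟨_, hn⟩, ⟨f ^ n, n, rfl⟩), Subtype.ext ?_⟩
    simp [hmap, mul_comm]
  · intro x y hxy
    refine ⟨1, ?_⟩
    have : (x : K) = y := congrArg (fun z : B => (z : K)) hxy
    rw [Subtype.ext this]

theorem isRegularRing_of_le {A B : Subalgebra k K} (hAB : A ≤ B) {f : K} (hfA : f ∈ A)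
    (hf0 : f ≠ 0) (hf : f⁻¹ ∈ B) (hB : ∀ b ∈ B, ∃ n : ℕ, f ^ n * b ∈ A) [IsRegularRing A] :
    IsRegularRing B := by
  let _ := (inclusion hAB).toAlgebra
  have := isLocalization_away_inclusion hAB ⟨f, hfA⟩ hf0 hf hB
  exact IsRegularRing.of_isLocalization (Submonoid.powers (⟨f, hfA⟩ : A))

theorem isRegularRing_of_cover {A : Subalgebra k K} (s : Set A) (hs : Ideal.span s = ⊤)
    (h : ∀ f ∈ s, (f : K) ≠ 0 ∧ ∃ B : Subalgebra k K, A ≤ B ∧ (f : K)⁻¹ ∈ B ∧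
      (∀ b ∈ B, ∃ n : ℕ, (f : K) ^ n * b ∈ A) ∧ IsRegularRing B) :
    IsRegularRing A := by
  refine isRegularRing_of_away s hs fun f hf => ?_
  obtain ⟨hf0, B, hAB, hfB, hB, hreg⟩ := h f hf
  let _ := (inclusion hAB).toAlgebra
  have := isLocalization_away_inclusion hAB f hf0 hfB hB
  exact IsRegularRing.of_ringEquiv
    (IsLocalization.algEquiv (Submonoid.powers f) B (Localization.Away f)).toRingEquiv

theorem isIntegrallyClosed_of_le {A B : Subalgebra k K} (hAB : A ≤ B) {f : K} (hfA : f ∈ A)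
    (hf0 : f ≠ 0) (hf : f⁻¹ ∈ B) (hB : ∀ b ∈ B, ∃ n : ℕ, f ^ n * b ∈ A) [IsIntegrallyClosed A] :
    IsIntegrallyClosed B := by
  let _ := (inclusion hAB).toAlgebra
  have := isLocalization_away_inclusion hAB ⟨f, hfA⟩ hf0 hf hB
  refine isIntegrallyClosed_of_isLocalization B (Submonoid.powers (⟨f, hfA⟩ : A))
    (powers_le_nonZeroDivisors_of_noZeroDivisors fun h => hf0 ?_)
  exact congrArg Subtype.val h

/-- If two elements of `A` generate the unit ideal, or form a regular sequence, an element of `K`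
that either of them multiplies into `A` lies in `A`. -/
def CoprimeIn (A : Subalgebra k K) (p q : K) : Prop :=
  ∀ f, f * p ∈ A → f * q ∈ A → f ∈ A

namespace CoprimeIn

variable {A : Subalgebra k K} {p q r : K}

theorem symm (h : A.CoprimeIn p q) : A.CoprimeIn q p := fun f h1 h2 => h f h2 h1

theorem one_right : A.CoprimeIn p 1 := fun f _ h => by simpa using h

theorem of_add_eq_one {a b : K} (ha : a ∈ A) (hb : b ∈ A) (h : a * p + b * q = 1) :
    A.CoprimeIn p q := fun f h1 h2 => by
  have : f = a * (f * p) + b * (f * q) := by linear_combination (-f) * h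
  rw [this]
  exact add_mem (mul_mem ha h1) (mul_mem hb h2)

theorem mul_right (hq : q ∈ A) (h1 : A.CoprimeIn p q) (h2 : A.CoprimeIn p r) :
    A.CoprimeIn p (q * r) := fun f hp hqr => by
  refine h1 f hp (h2 (f * q) ?_ (by rwa [mul_assoc]))
  rw [mul_right_comm]
  exact mul_mem hp hq

theorem pow_right (hq : q ∈ A) (h : A.CoprimeIn p q) (n : ℕ) : A.CoprimeIn p (q ^ n) := by
  induction n with
  | zero => simpa using one_right
  | succ n ih => rw [pow_succ']; exact h.mul_right hq ih

theorem pow_pow (hp : p ∈ A) (hq : q ∈ A) (h : A.CoprimeIn p q) (m n : ℕ) :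
    A.CoprimeIn (p ^ m) (q ^ n) :=
  ((h.pow_right hq n).symm.pow_right hp m).symm

theorem prod_right {ι : Type*} (s : Finset ι) (g : ι → K) (hg : ∀ i ∈ s, g i ∈ A)
    (h : ∀ i ∈ s, A.CoprimeIn p (g i)) : A.CoprimeIn p (∏ i ∈ s, g i) := by
  classical
  induction s using Finset.induction_on with
  | empty => simpa using one_right
  | insert a s ha ih =>
    rw [Finset.prod_insert ha]
    exact (h a (by simp)).mul_right (hg a (by simp))
      (ih (fun i hi => hg i (by simp [hi])) fun i hi => h i (by simp [hi]))

theorem unit_mul_right {u : K} (hu0 : u ≠ 0) (hu : u⁻¹ ∈ A) (h : A.CoprimeIn p q) :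
    A.CoprimeIn p (u * q) := fun f h1 h2 => h f h1 <| by
  have : f * q = u⁻¹ * (f * (u * q)) := by field_simp
  rw [this]
  exact mul_mem hu h2

theorem unit_mul_unit_mul {u v : K} (hu0 : u ≠ 0) (hu : u⁻¹ ∈ A) (hv0 : v ≠ 0) (hv : v⁻¹ ∈ A)
    (h : A.CoprimeIn p q) : A.CoprimeIn (u * p) (v * q) :=
  ((h.unit_mul_right hv0 hv).symm.unit_mul_right hu0 hu).symm

/-- Division by pairwise coprime elements can be carried out simultaneously. -/
theorem div_prod_mem {ι : Type*} (s : Finset ι) (g : ι → K)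
    (hg : ∀ i ∈ s, g i ∈ A) (hgh : ∀ i ∈ s, ∀ j ∈ s, i ≠ j → A.CoprimeIn (g i) (g j)) {c : K}
    (hg0 : ∀ i ∈ s, g i ≠ 0) (hcA : c ∈ A) (hc : ∀ i ∈ s, c / g i ∈ A) :
    c / ∏ i ∈ s, g i ∈ A := by
  classical
  induction s using Finset.cons_induction with
  | empty => simpa using hcA
  | cons a s ha ih =>
    have hcs := ih (fun i hi => hg i (by simp [hi]))
      (fun i hi j hj => hgh i (by simp [hi]) j (by simp [hj]))
      (fun i hi => hg0 i (by simp [hi])) (fun i hi => hc i (by simp [hi]))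
    have hP0 : ∏ i ∈ s, g i ≠ 0 := Finset.prod_ne_zero_iff.mpr fun i hi => hg0 i (by simp [hi])
    have ha0 : g a ≠ 0 := hg0 a (by simp)
    have hcop : A.CoprimeIn (g a) (∏ i ∈ s, g i) :=
      prod_right s g (fun i hi => hg i (by simp [hi])) fun i hi =>
        hgh a (by simp) i (by simp [hi]) (by rintro rfl; exact ha hi)
    rw [Finset.prod_cons]
    -- Multiplying the full quotient by one of the two coprime factors cancels that factor and
    -- leaves a quotient already known to lie in `A`.
    refine hcop _ ?_ ?_
    · convert hcs using 1
      field_simp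
    · convert hc a (by simp) using 1
      field_simp

end CoprimeIn

end Subalgebra

/-! ### Laurent monomials and Laurent polynomial subalgebras of a field -/

section Laurent

variable {N K : Type*} [Field K]

section Monomial

variable [Fintype N]

/-- The Laurent monomial `∏ i, x i ^ v i`. -/
def laurentMonomial (x : N → K) (v : N → ℤ) : K := ∏ i, x i ^ v i

namespace laurentMonomial

variable {x : N → K}

@[simp] theorem zero : laurentMonomial x 0 = 1 := by simp [laurentMonomial]

theorem add (hx : ∀ i, x i ≠ 0) (v w : N → ℤ) :
    laurentMonomial x (v + w) = laurentMonomial x v * laurentMonomial x w := by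
  simp [laurentMonomial, zpow_add₀ (hx _), Finset.prod_mul_distrib]

theorem neg (v : N → ℤ) : laurentMonomial x (-v) = (laurentMonomial x v)⁻¹ := by
  simp [laurentMonomial]

theorem ne_zero (hx : ∀ i, x i ≠ 0) (v : N → ℤ) : laurentMonomial x v ≠ 0 :=
  Finset.prod_ne_zero_iff.mpr fun i _ => zpow_ne_zero _ (hx i)

theorem single [DecidableEq N] (i : N) (m : ℤ) : laurentMonomial x (Pi.single i m) = x i ^ m := by
  rw [laurentMonomial, Finset.prod_eq_single i] <;> simp +contextual

theorem nsmul (hx : ∀ i, x i ≠ 0) (n : ℕ) (v : N → ℤ) :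
    laurentMonomial x (n • v) = laurentMonomial x v ^ n := by
  induction n with
  | zero => simp
  | succ n ih => rw [succ_nsmul, add hx, ih, pow_succ]

theorem update [DecidableEq N] (hx : ∀ i, x i ≠ 0) {p : K} (hp : p ≠ 0) (k : N) (v : N → ℤ) :
    laurentMonomial (Function.update x k (p / x k)) v =
      laurentMonomial x (Function.update v k (-v k)) * p ^ v k := by
  rw [laurentMonomial, laurentMonomial, ← Finset.mul_prod_erase _ _ (Finset.mem_univ k),
    ← Finset.mul_prod_erase _ _ (Finset.mem_univ k),
    Finset.prod_congr rfl (g := fun i => x i ^ Function.update v k (-v k) i)]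
  · simp only [Function.update_self, div_zpow, zpow_neg]
    field_simp [hx k]
  · intro i hi
    simp [Finset.ne_of_mem_erase hi]

end laurentMonomial

end Monomial

variable [Algebra ℚ K]

/-- The algebra of Laurent polynomials in a family of elements of a field. -/
def laurentAlgebra (x : N → K) : Subalgebra ℚ K :=
  Algebra.adjoin ℚ (Set.range x ∪ Set.range fun i => (x i)⁻¹)

namespace laurentAlgebra

variable {x : N → K}

theorem var_mem (x : N → K) (i : N) : x i ∈ laurentAlgebra x :=
  Algebra.subset_adjoin (Or.inl ⟨i, rfl⟩)

theorem inv_mem (x : N → K) (i : N) : (x i)⁻¹ ∈ laurentAlgebra x :=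
  Algebra.subset_adjoin (Or.inr ⟨i, rfl⟩)

theorem le_of_mem {L : Subalgebra ℚ K} (h1 : ∀ i, x i ∈ L) (h2 : ∀ i, (x i)⁻¹ ∈ L) :
    laurentAlgebra x ≤ L := by
  refine Algebra.adjoin_le ?_
  rintro _ (⟨i, rfl⟩ | ⟨i, rfl⟩)
  exacts [h1 i, h2 i]

end laurentAlgebra

theorem zpow_mem_of_inv_mem {L : Subalgebra ℚ K} {a : K} (h : a ∈ L) (h' : a⁻¹ ∈ L) (n : ℤ) :
    a ^ n ∈ L := by
  cases n with
  | ofNat n => simpa using pow_mem h n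
  | negSucc n => rw [zpow_negSucc, ← inv_pow]; exact pow_mem h' _

theorem zpow_mem_of_nonneg {L : Subalgebra ℚ K} {a : K} (h : a ∈ L) {n : ℤ} (hn : 0 ≤ n) :
    a ^ n ∈ L := by
  lift n to ℕ using hn
  simpa using pow_mem h n

variable [Fintype N]

theorem laurentMonomial_mem {L : Subalgebra ℚ K} {x : N → K} {v : N → ℤ}
    (h1 : ∀ i, v i ≠ 0 → x i ∈ L) (h2 : ∀ i, v i < 0 → (x i)⁻¹ ∈ L) :
    laurentMonomial x v ∈ L := by
  refine prod_mem fun i _ => ?_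
  rcases eq_or_ne (v i) 0 with h | h
  · simp [h, one_mem]
  · rcases lt_or_ge (v i) 0 with h' | h'
    · exact zpow_mem_of_inv_mem (h1 i h) (h2 i h') _
    · exact zpow_mem_of_nonneg (h1 i h) h'

theorem laurentAlgebra.monomial_mem (x : N → K) (v : N → ℤ) :
    laurentMonomial x v ∈ laurentAlgebra x :=
  laurentMonomial_mem (fun i _ => var_mem x i) fun i _ => inv_mem x i

open AddMonoidAlgebra in
/-- Evaluation of formal Laurent polynomials at a family of nonzero elements of a field. -/
noncomputable def laurentEval (x : N → K) (hx : ∀ i, x i ≠ 0) :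
    AddMonoidAlgebra ℚ (N → ℤ) →ₐ[ℚ] K :=
  AddMonoidAlgebra.lift ℚ K (N → ℤ)
    { toFun := fun v => laurentMonomial x v.toAdd
      map_one' := laurentMonomial.zero
      map_mul' := fun v w => laurentMonomial.add hx v.toAdd w.toAdd }

theorem laurentEval_single {x : N → K} (hx : ∀ i, x i ≠ 0) (v : N → ℤ) (c : ℚ) :
    laurentEval x hx (.single v c) = c • laurentMonomial x v := by
  simp [laurentEval]

theorem laurentEval_single_one {x : N → K} (hx : ∀ i, x i ≠ 0) (v : N → ℤ) :
    laurentEval x hx (.single v 1) = laurentMonomial x v := by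
  rw [laurentEval_single, one_smul]

/-- Multiplying a finite relation by a monomial with large exponents `u` turns it into a relation
between ordinary monomials, which algebraic independence forbids. -/
theorem AlgebraicIndependent.linearIndependent_laurentMonomial {x : N → K}
    (h : AlgebraicIndependent ℚ x) : LinearIndependent ℚ (laurentMonomial x) := by
  have hx : ∀ i, x i ≠ 0 := h.ne_zero
  have hmon : LinearIndependent ℚ
      fun m : N →₀ ℕ => MvPolynomial.aeval x (MvPolynomial.monomial m (1 : ℚ)) := by
    have := (MvPolynomial.basisMonomials N ℚ).linearIndependent.map'
      (MvPolynomial.aeval x : MvPolynomial N ℚ →ₐ[ℚ] K).toLinearMap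
      (LinearMap.ker_eq_bot.mpr h)
    simpa [Function.comp_def] using! this
  rw [linearIndependent_iff']
  intro s g hg v hv
  obtain ⟨u, hu⟩ : ∃ u : N → ℤ, ∀ w ∈ s, ∀ i, 0 ≤ w i + u i := by
    refine ⟨fun i => ∑ w ∈ s, |w i|, fun w hw i => ?_⟩
    have h1 : |w i| ≤ ∑ w ∈ s, |w i| :=
      Finset.single_le_sum (f := fun w : N → ℤ => |w i|) (fun _ _ => abs_nonneg _) hw
    have h2 := neg_abs_le (w i)
    dsimp only
    linarith
  let e : (N → ℤ) → N →₀ ℕ := fun w => Finsupp.equivFunOnFinite.symm fun i => (w i + u i).toNat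
  have he : Set.InjOn e s := by
    intro w hw w' hw' hww
    funext i
    have h1 := DFunLike.congr_fun hww i
    simp only [e, Finsupp.equivFunOnFinite_symm_apply_apply] at h1
    have h2 := hu w hw i
    have h3 := hu w' hw' i
    omega
  have hsum : ∑ w ∈ s, g w • MvPolynomial.aeval x (MvPolynomial.monomial (e w) (1 : ℚ)) = 0 := by
    have hmul := congrArg (· * laurentMonomial x u) hg
    simp only [zero_mul, Finset.sum_mul] at hmul
    rw [← hmul]
    refine Finset.sum_congr rfl fun w hw => ?_
    rw [smul_mul_assoc, ← laurentMonomial.add hx, MvPolynomial.aeval_monomial, map_one, one_mul,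
      Finsupp.prod_fintype _ _ (by simp)]
    congr 1
    refine Finset.prod_congr rfl fun i _ => ?_
    simp only [e, Finsupp.equivFunOnFinite_symm_apply_apply, Pi.add_apply]
    rw [← zpow_natCast, Int.toNat_of_nonneg (hu w hw i)]
  have hs : LinearIndependent ℚ fun w : s => MvPolynomial.aeval x
      (MvPolynomial.monomial (e w) (1 : ℚ)) :=
    hmon.comp (fun w : s => e w) fun a b hab => Subtype.ext (he a.2 b.2 hab)
  rw [← Finset.sum_coe_sort] at hsum
  exact Fintype.linearIndependent_iff.mp hs (fun w => g w) hsum ⟨v, hv⟩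

theorem laurentEval_eq_sum {x : N → K} (hx : ∀ i, x i ≠ 0) (F : AddMonoidAlgebra ℚ (N → ℤ)) :
    laurentEval x hx F = ∑ v ∈ F.coeff.support, F.coeff v • laurentMonomial x v := by
  conv_lhs => rw [← F.sum_coeff_single]
  simp [Finsupp.sum, laurentEval_single]

theorem AlgebraicIndependent.laurentEval_injective {x : N → K} (h : AlgebraicIndependent ℚ x) :
    Function.Injective (laurentEval x h.ne_zero) := by
  rw [injective_iff_map_eq_zero]
  intro F hF
  rw [laurentEval_eq_sum] at hF
  have := linearIndependent_iff'.mp h.linearIndependent_laurentMonomial _ _ hF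
  ext v
  by_contra hv
  exact hv (this v (Finsupp.mem_support_iff.mpr hv))

theorem laurentEval_mem {x : N → K} (hx : ∀ i, x i ≠ 0) (F : AddMonoidAlgebra ℚ (N → ℤ)) :
    laurentEval x hx F ∈ laurentAlgebra x := by
  rw [laurentEval_eq_sum]
  exact sum_mem fun v _ => Subalgebra.smul_mem _ (laurentAlgebra.monomial_mem x v) _

theorem mem_laurentAlgebra_iff {x : N → K} (hx : ∀ i, x i ≠ 0) {f : K} :
    f ∈ laurentAlgebra x ↔ ∃ F, laurentEval x hx F = f := by
  classical
  refine ⟨fun hf => ?_, ?_⟩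
  · suffices h : laurentAlgebra x ≤ (laurentEval x hx).range from h hf
    refine laurentAlgebra.le_of_mem (fun i => ⟨.single (Pi.single i 1) 1, ?_⟩)
      fun i => ⟨.single (Pi.single i (-1)) 1, ?_⟩ <;>
    simp [laurentEval_single, laurentMonomial.single]
  · rintro ⟨F, rfl⟩
    exact laurentEval_mem hx F

end Laurent

namespace AddMonoidAlgebra

/-! ### Restricting the support of a formal Laurent polynomial -/

variable {G : Type*}

open Classical in
/-- The part of `F` supported in `S`. -/
noncomputable def restrictSupport (S : Set G) : AddMonoidAlgebra ℚ G →+ AddMonoidAlgebra ℚ G where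
  toFun F := .ofCoeff (F.coeff.filter (· ∈ S))
  map_zero' := by ext; simp [Finsupp.filter_apply]
  map_add' F F' := by ext; simp [Finsupp.filter_add]

variable {S S' : Set G}

open Classical in
theorem coeff_restrictSupport (F : AddMonoidAlgebra ℚ G) (u : G) :
    (restrictSupport S F).coeff u = if u ∈ S then F.coeff u else 0 := by
  simp [restrictSupport, Finsupp.filter_apply]

theorem restrictSupport_eq_self {F : AddMonoidAlgebra ℚ G} (h : ∀ u, F.coeff u ≠ 0 → u ∈ S) :
    restrictSupport S F = F := by
  ext u
  rw [coeff_restrictSupport]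
  by_cases hu : F.coeff u = 0
  · simp [hu]
  · simp [h u hu]

theorem restrictSupport_eq_zero {F : AddMonoidAlgebra ℚ G} (h : ∀ u, F.coeff u ≠ 0 → u ∉ S) :
    restrictSupport S F = 0 := by
  ext u
  rw [coeff_restrictSupport]
  by_cases hu : F.coeff u = 0
  · simp [hu]
  · simp [h u hu]

theorem restrictSupport_restrictSupport_of_subset (h : S ⊆ S') (F : AddMonoidAlgebra ℚ G) :
    restrictSupport S (restrictSupport S' F) = restrictSupport S F := by
  ext u
  simp only [coeff_restrictSupport]
  by_cases hu : u ∈ S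
  · simp [hu, h hu]
  · simp [hu]

theorem coeff_restrictSupport_ne_zero {F : AddMonoidAlgebra ℚ G} {u : G}
    (h : (restrictSupport S F).coeff u ≠ 0) : u ∈ S := by
  rw [coeff_restrictSupport] at h
  by_contra hu
  exact h (by simp [hu])

theorem sum_restrictSupport_fiber {A : Type*} [DecidableEq A] (r : G → A)
    (F : AddMonoidAlgebra ℚ G) :
    ∑ n ∈ F.coeff.support.image r, restrictSupport {u | r u = n} F = F := by
  ext u
  rw [coeff_sum, Finsupp.finsetSum_apply]
  simp only [coeff_restrictSupport, Set.mem_ofPred_eq]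
  by_cases hu : F.coeff u = 0
  · simp [hu]
  · rw [Finset.sum_eq_single (r u) (fun b _ hb => by simp [hb.symm]), if_pos rfl]
    exact fun h => absurd (Finset.mem_image_of_mem r (Finsupp.mem_support_iff.mpr hu)) h

variable [AddCommGroup G]

/-- Translation by an exponent of `p` moves nothing into or out of `S`; in the applications `S` is
cut out by a grading in which `p` has degree zero. -/
theorem restrictSupport_mul {p : AddMonoidAlgebra ℚ G}
    (hp : ∀ v, p.coeff v ≠ 0 → ∀ u, v + u ∈ S ↔ u ∈ S) (F : AddMonoidAlgebra ℚ G) :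
    restrictSupport S (p * F) = p * restrictSupport S F := by
  rw [← p.sum_coeff_single, Finsupp.sum, Finset.sum_mul, Finset.sum_mul, map_sum]
  refine Finset.sum_congr rfl fun v hv => ?_
  ext u
  rw [coeff_restrictSupport, coeff_single_mul_apply, coeff_single_mul_apply, coeff_restrictSupport]
  have := hp v (Finsupp.mem_support_iff.mp hv) (-v + u)
  rw [add_neg_cancel_left] at this
  by_cases hu : u ∈ S
  · rw [if_pos hu, if_pos (this.mp hu)]
  · rw [if_neg hu, if_neg fun h => hu (this.mpr h), mul_zero]

theorem restrictSupport_pow_mul {p : AddMonoidAlgebra ℚ G}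
    (hp : ∀ v, p.coeff v ≠ 0 → ∀ u, v + u ∈ S ↔ u ∈ S) (n : ℕ) (F : AddMonoidAlgebra ℚ G) :
    restrictSupport S (p ^ n * F) = p ^ n * restrictSupport S F := by
  induction n with
  | zero => simp
  | succ n ih => rw [pow_succ', mul_assoc, restrictSupport_mul hp, ih, mul_assoc]

theorem restrictSupport_prod_pow_mul {ι : Type*} (s : Finset ι) (p : ι → AddMonoidAlgebra ℚ G)
    (hp : ∀ i ∈ s, ∀ v, (p i).coeff v ≠ 0 → ∀ u, v + u ∈ S ↔ u ∈ S) (n : ι → ℕ)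
    (F : AddMonoidAlgebra ℚ G) :
    restrictSupport S ((∏ i ∈ s, p i ^ n i) * F) = (∏ i ∈ s, p i ^ n i) * restrictSupport S F := by
  induction s using Finset.cons_induction generalizing F with
  | empty => simp
  | cons a s ha ih =>
    rw [Finset.prod_cons, mul_assoc, restrictSupport_pow_mul (hp a (by simp)),
      ih (fun i hi => hp i (by simp [hi])), mul_assoc]

/-- If `1 + t ^ v` is homogeneous of degree `0` for a grading that separates `w` from `0`, then it
is coprime to `1 + t ^ w`. -/
theorem one_add_single_dvd_of_dvd_mul {v w : G} (d : G →+ ℤ) (hv : d v = 0) (hw : d w ≠ 0)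
    {F : AddMonoidAlgebra ℚ G}
    (h : (1 + single v 1 : AddMonoidAlgebra ℚ G) ∣ (1 + single w 1) * F) :
    (1 + single v 1 : AddMonoidAlgebra ℚ G) ∣ F := by
  obtain ⟨b, hb⟩ : ∃ b : ℕ, ∀ u, F.coeff u ≠ 0 → |d u| ≤ b := by
    refine ⟨∑ u ∈ F.coeff.support, (d u).natAbs, fun u hu => ?_⟩
    have := Finset.single_le_sum (f := fun u => (d u).natAbs) (fun _ _ => Nat.zero_le _)
      (Finsupp.mem_support_iff.mpr hu)
    rw [Int.abs_eq_natAbs]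
    exact_mod_cast this
  -- Translation by `n • w` shifts degrees by more than 2b, hence out of the window [-b, b] that
  -- contains all degrees of `F`.
  set n := 2 * b + 1
  let S : Set G := {u | |d u| ≤ b}
  have hpow : (single w 1 : AddMonoidAlgebra ℚ G) ^ n = single (n • w) 1 := by
    rw [single_pow, one_pow]
  -- Since 1 + t^w divides 1 - (-t^w)^n, the element F is congruent to (-t^w)^n F modulo 1 + t^v.
  -- Restriction to the window kills the second term and, as 1 + t^v has degree zero, keeps the
  -- divisibility.
  have hdvd : (1 + single v 1 : AddMonoidAlgebra ℚ G) ∣ F - (-1) ^ n * (single (n • w) 1 * F) := by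
    obtain ⟨c, hc⟩ : (1 + single w 1 : AddMonoidAlgebra ℚ G) ∣ 1 - (-1) ^ n * single (n • w) 1 := by
      have := sub_dvd_pow_sub_pow (1 : AddMonoidAlgebra ℚ G) (-single w 1) n
      rwa [sub_neg_eq_add, one_pow, neg_pow, hpow] at this
    have : F - (-1) ^ n * (single (n • w) 1 * F) = (1 + single w 1) * F * c := by
      rw [mul_right_comm, ← hc]; ring
    rw [this]
    exact h.mul_right c
  obtain ⟨c, hc⟩ := hdvd
  have hres := congrArg (restrictSupport S) hc
  have h0 : restrictSupport S ((-1) ^ n * (single (n • w) 1 * F)) = 0 := by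
    refine restrictSupport_eq_zero fun u hu => ?_
    have hu' : F.coeff (-(n • w) + u) ≠ 0 := by
      intro h0
      refine hu ?_
      rcases neg_one_pow_eq_or (AddMonoidAlgebra ℚ G) n with h1 | h1 <;>
        simp [h1, coeff_single_mul_apply, h0]
    have h1 := hb _ hu'
    rw [map_add, map_neg, map_nsmul, nsmul_eq_mul] at h1
    simp only [S, Set.mem_ofPred_eq, not_le]
    have h2 : (1 : ℤ) ≤ |d w| := Int.one_le_abs hw
    have h3 : |(n : ℤ) * d w| = n * |d w| := by rw [abs_mul, Nat.abs_cast]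
    have h4 : |(n : ℤ) * d w| ≤ |-((n : ℤ) * d w) + d u| + |d u| := by
      calc |(n : ℤ) * d w| = |d u - (-((n : ℤ) * d w) + d u)| := by ring_nf
        _ ≤ |d u| + |-((n : ℤ) * d w) + d u| := abs_sub _ _
        _ = _ := add_comm _ _
    have h5 : (n : ℤ) ≤ n * |d w| := le_mul_of_one_le_right (by positivity) h2
    have h6 : (n : ℤ) = 2 * b + 1 := by simp [n]
    linarith
  rw [map_sub, h0, sub_zero, restrictSupport_eq_self (S := S) hb, restrictSupport_mul] at hres
  · exact ⟨_, hres⟩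
  · intro a ha u
    have hda : d a = 0 := by
      by_contra hda
      have h1 : a ≠ 0 := by rintro rfl; exact hda (map_zero d)
      have h2 : a ≠ v := by rintro rfl; exact hda hv
      exact ha (by simp [one_def, h1.symm, h2.symm])
    simp [S, hda]

end AddMonoidAlgebra

/-! ### Elements that are Laurent polynomials in several neighbouring families -/

section

variable {N K : Type*} [Fintype N] [Field K] [Algebra ℚ K]

open AddMonoidAlgebra

theorem laurentEval_one_add_single {x : N → K} (hx : ∀ i, x i ≠ 0) (v : N → ℤ) :
    laurentEval x hx (1 + single v 1) = 1 + laurentMonomial x v := by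
  simp [laurentEval_single]

/-- Algebraic independence lifts the two memberships to a formal identity (1 + t^w) F = (1 + t^v) G;
then 1 + t^v divides F and can be cancelled. -/
theorem AlgebraicIndependent.coprimeIn_laurentAlgebra {x : N → K} (h : AlgebraicIndependent ℚ x)
    {v w : N → ℤ} (d : (N → ℤ) →+ ℤ) (hv : d v = 0) (hw : d w ≠ 0) :
    (laurentAlgebra x).CoprimeIn (1 + laurentMonomial x v) (1 + laurentMonomial x w) := by
  intro f h1 h2
  rw [mem_laurentAlgebra_iff h.ne_zero] at h1 h2
  obtain ⟨F, hF⟩ := h1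
  obtain ⟨G, hG⟩ := h2
  have hp : (1 + single v 1 : AddMonoidAlgebra ℚ (N → ℤ)) ≠ 0 := by
    intro h0
    have h1 := congrArg (fun F => F.coeff v) h0
    by_cases hv0 : v = 0
    · simp [one_def, hv0] at h1
    · simp [one_def, Ne.symm hv0] at h1
  have hdvd : (1 + single w 1) * F = (1 + single v 1) * G := by
    apply h.laurentEval_injective
    rw [map_mul, map_mul, hF, hG, laurentEval_one_add_single, laurentEval_one_add_single]
    ring
  obtain ⟨c, rfl⟩ := one_add_single_dvd_of_dvd_mul d hv hw ⟨G, hdvd⟩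
  have hp' : 1 + laurentMonomial x v ≠ 0 := by
    rw [← laurentEval_one_add_single h.ne_zero]
    exact fun h0 => hp (h.laurentEval_injective (by rw [h0, map_zero]))
  rw [map_mul, laurentEval_one_add_single, mul_comm] at hF
  rw [← mul_right_cancel₀ hp' hF]
  exact laurentEval_mem _ _

variable [DecidableEq N]

/-- If `F` is also a Laurent polynomial after replacing `x k` by `P / x k`, then its part of degree
`-m` in `x k` is divisible by `P ^ m`. -/
theorem AlgebraicIndependent.pow_dvd_restrictSupport {x : N → K} (h : AlgebraicIndependent ℚ x)
    (k : N) {P : AddMonoidAlgebra ℚ (N → ℤ)} (hP0 : P ≠ 0) (hP : ∀ v, P.coeff v ≠ 0 → v k = 0)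
    {F : AddMonoidAlgebra ℚ (N → ℤ)}
    (hF : laurentEval x h.ne_zero F ∈
      laurentAlgebra (Function.update x k (laurentEval x h.ne_zero P / x k))) (m : ℕ) :
    P ^ m ∣ restrictSupport {u : N → ℤ | u k = -(m : ℤ)} F := by
  set p := laurentEval x h.ne_zero P with hp
  have hp0 : p ≠ 0 := fun h0 => hP0 (h.laurentEval_injective (by rw [← hp, h0, map_zero]))
  have hx' : ∀ i, Function.update x k (p / x k) i ≠ 0 := by
    intro i
    by_cases hi : i = k
    · subst hi; simp [hp0, h.ne_zero i]
    · simp [hi, h.ne_zero i]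
  obtain ⟨F', hF'⟩ := (mem_laurentAlgebra_iff hx').mp hF
  -- The power `P ^ b` clears the negative powers of `P` that arise when `F'` is rewritten in the
  -- old variables.
  obtain ⟨b, hb⟩ : ∃ b : ℕ, ∀ v ∈ F'.coeff.support, 0 ≤ b + v k := by
    refine ⟨∑ u ∈ F'.coeff.support, (u k).natAbs, fun u hu => ?_⟩
    have := Finset.single_le_sum (f := fun u : N → ℤ => (u k).natAbs) (fun _ _ => Nat.zero_le _) hu
    have h2 : ((u k).natAbs : ℤ) ≤ (∑ u ∈ F'.coeff.support, (u k).natAbs : ℕ) := by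
      exact_mod_cast this
    omega
  have hsum : P ^ b * F = ∑ v ∈ F'.coeff.support,
      P ^ (b + v k).toNat * single (Function.update v k (-v k)) (F'.coeff v) := by
    apply h.laurentEval_injective
    rw [map_mul, ← hF', laurentEval_eq_sum hx', map_sum, map_pow, ← hp, Finset.mul_sum]
    refine Finset.sum_congr rfl fun v hv => ?_
    rw [map_mul, map_pow, ← hp, laurentEval_single, laurentMonomial.update h.ne_zero hp0,
      ← zpow_natCast, ← zpow_natCast, Int.toNat_of_nonneg (hb v hv), zpow_add₀ hp0,
      mul_smul_comm, mul_smul_comm]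
    congr 1
    ring
  have hinv : ∀ v, P.coeff v ≠ 0 → ∀ u, v + u ∈ {u : N → ℤ | u k = -m} ↔
      u ∈ {u : N → ℤ | u k = -m} := fun v hv u => by simp [hP v hv]
  have hres := congrArg (restrictSupport {u : N → ℤ | u k = -m}) hsum
  rw [restrictSupport_pow_mul hinv, map_sum] at hres
  -- Only the terms of `F'` with `v k = m` contribute to degree `-m` in `x k`, and each of them
  -- carries the factor `P ^ (b + m)`.
  have hdvd : P ^ (b + m) ∣ P ^ b * restrictSupport {u : N → ℤ | u k = -m} F := by
    rw [hres]
    refine Finset.dvd_sum fun v hv => ?_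
    rw [restrictSupport_pow_mul hinv]
    by_cases hvk : v k = m
    · rw [hvk]
      exact dvd_mul_of_dvd_left (by norm_cast) _
    · rw [restrictSupport_eq_zero, mul_zero]
      · exact dvd_zero _
      · intro u hu
        have : u = Function.update v k (-v k) := by
          by_contra hne
          exact hu (by simp [Ne.symm hne])
        subst this
        simpa using hvk
  rw [pow_add] at hdvd
  exact (mul_dvd_mul_iff_left (pow_ne_zero b hP0)).mp hdvd

/-- An element which is a Laurent polynomial in `x` and in each of the families obtained by
replacing `x k` by `P k / x k` for one `k ∈ I` is a polynomial in the `x k`, the `P k / x k`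
(`k ∈ I`), and the remaining variables and their inverses. -/
theorem AlgebraicIndependent.mem_of_forall_mem_laurentAlgebra {x : N → K}
    (h : AlgebraicIndependent ℚ x) (I : Finset N) (P : N → AddMonoidAlgebra ℚ (N → ℤ))
    (hP0 : ∀ k ∈ I, P k ≠ 0) (hP : ∀ k ∈ I, ∀ v, (P k).coeff v ≠ 0 → ∀ i ∈ I, v i = 0)
    (hcop : ∀ k ∈ I, ∀ l ∈ I, k ≠ l → (laurentAlgebra x).CoprimeIn
      (laurentEval x h.ne_zero (P k)) (laurentEval x h.ne_zero (P l)))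
    {f : K} (hf : f ∈ laurentAlgebra x)
    (hfI : ∀ k ∈ I, f ∈
      laurentAlgebra (Function.update x k (laurentEval x h.ne_zero (P k) / x k)))
    {L : Subalgebra ℚ K} (h1 : ∀ i, x i ∈ L) (h2 : ∀ i ∉ I, (x i)⁻¹ ∈ L)
    (h3 : ∀ k ∈ I, laurentEval x h.ne_zero (P k) / x k ∈ L) : f ∈ L := by
  obtain ⟨F, rfl⟩ := (mem_laurentAlgebra_iff h.ne_zero).mp hf
  -- The multidegree in the variables of `I`. No `P k` involves these variables, so `F` can be
  -- treated one multidegree `n` at a time.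
  let r : (N → ℤ) → N → ℤ := fun u i => if i ∈ I then u i else 0
  rw [← sum_restrictSupport_fiber r F, map_sum]
  refine sum_mem fun n _ => ?_
  set S : Set (N → ℤ) := {u | r u = n}
  have hS : ∀ k ∈ I, ∀ u ∈ S, u k = n k := by
    intro k hk u hu
    have := congrFun (show r u = n from hu) k
    simpa [r, hk] using this
  have hinv : ∀ k ∈ I, ∀ v, (P k).coeff v ≠ 0 → ∀ u, v + u ∈ S ↔ u ∈ S := by
    intro k hk v hv u
    have : r (v + u) = r u := by
      funext i
      by_cases hi : i ∈ I
      · simp [r, hi, hP k hk v hv i hi]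
      · simp [r, hi]
    change r (v + u) = n ↔ r u = n
    rw [this]
  have hp0 : ∀ k ∈ I, laurentEval x h.ne_zero (P k) ≠ 0 := fun k hk h0 =>
    hP0 k hk (h.laurentEval_injective (by rw [h0, map_zero]))
  -- For `n k ≥ 0` the truncated exponent is zero and nothing has to be divided out.
  have hdiv : ∀ k ∈ I, laurentEval x h.ne_zero (restrictSupport S F) /
      laurentEval x h.ne_zero (P k) ^ (-n k).toNat ∈ laurentAlgebra x := by
    intro k hk
    rcases le_or_gt 0 (n k) with hn | hn
    · rw [Int.toNat_of_nonpos (by omega), pow_zero, div_one]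
      exact laurentEval_mem _ _
    · obtain ⟨G, hG⟩ := h.pow_dvd_restrictSupport k (hP0 k hk)
        (fun v hv => hP k hk v hv k hk) (hfI k hk) (-n k).toNat
      have hsub : S ⊆ {u : N → ℤ | u k = -((-n k).toNat : ℤ)} := by
        intro u hu
        have := hS k hk u hu
        change u k = _
        omega
      rw [← restrictSupport_restrictSupport_of_subset hsub, hG,
        restrictSupport_pow_mul (hinv k hk), map_mul, map_pow,
        mul_div_cancel_left₀ _ (pow_ne_zero _ (hp0 k hk))]
      exact laurentEval_mem _ _
  -- Coprimality merges the separate divisions into one. Each negative power of `x k` is then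
  -- matched by the same power of `P k`, producing a power of `P k / x k`.
  have hprod := Subalgebra.CoprimeIn.div_prod_mem I
    (fun k => laurentEval x h.ne_zero (P k) ^ (-n k).toNat)
    (fun k _ => pow_mem (laurentEval_mem _ _) _)
    (fun k hk l hl hkl => (hcop k hk l hl hkl).pow_pow (laurentEval_mem _ _)
      (laurentEval_mem _ _) _ _)
    (fun k hk => pow_ne_zero _ (hp0 k hk)) (laurentEval_mem _ _) hdiv
  obtain ⟨H, hH⟩ := (mem_laurentAlgebra_iff h.ne_zero).mp hprod
  have hFH : restrictSupport S F = (∏ k ∈ I, P k ^ (-n k).toNat) * restrictSupport S H := by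
    rw [← restrictSupport_prod_pow_mul I P hinv]
    have : restrictSupport S F = (∏ k ∈ I, P k ^ (-n k).toNat) * H := by
      apply h.laurentEval_injective
      rw [map_mul, hH, map_prod]
      simp only [map_pow]
      rw [mul_div_cancel₀]
      exact Finset.prod_ne_zero_iff.mpr fun k hk => pow_ne_zero _ (hp0 k hk)
    rw [← this, restrictSupport_restrictSupport_of_subset subset_rfl]
  rw [hFH, map_mul, laurentEval_eq_sum h.ne_zero (restrictSupport S H), Finset.mul_sum, map_prod]
  refine sum_mem fun v hv => ?_
  rw [mul_smul_comm]
  refine Subalgebra.smul_mem _ ?_ _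
  have hvS : v ∈ S := coeff_restrictSupport_ne_zero (Finsupp.mem_support_iff.mp hv)
  rw [laurentMonomial, ← Finset.prod_mul_prod_compl I, ← mul_assoc, ← Finset.prod_mul_distrib]
  refine mul_mem (prod_mem fun k hk => ?_) (prod_mem fun i hi => ?_)
  · rw [hS k hk v hvS, map_pow]
    rcases le_or_gt 0 (n k) with hn | hn
    · rw [Int.toNat_of_nonpos (by omega), pow_zero, one_mul]
      exact zpow_mem_of_nonneg (h1 k) hn
    · have : laurentEval x h.ne_zero (P k) ^ (-n k).toNat * x k ^ n k =
          (laurentEval x h.ne_zero (P k) / x k) ^ (-n k).toNat := by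
        have hk' : x k ^ n k = (x k ^ (-n k).toNat)⁻¹ := by
          rw [← zpow_natCast, ← zpow_neg]
          congr 1
          omega
        rw [hk', div_pow, div_eq_mul_inv]
      rw [this]
      exact pow_mem (h3 k hk) _
  · exact zpow_mem_of_inv_mem (h1 i) (h2 i (Finset.mem_compl.mp hi)) _

end

/-! ### Mutation of quivers -/

namespace IceQuiver

variable {N : Type*} (Q : IceQuiver N)

theorem B_self (i : N) : Q.B i i = 0 := by
  have := Q.skew i i
  omega

/-- The exponent of the first monomial of the exchange relation at `k`. -/
def posRow (k : N) : N → ℤ := fun j => max (Q.B k j) 0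

/-- The exponent of the second monomial of the exchange relation at `k`. -/
def negRow (k : N) : N → ℤ := fun j => max (-Q.B k j) 0

theorem posRow_eq_add (k : N) : Q.posRow k = Q.negRow k + Q.B k := by
  funext j
  simp only [posRow, negRow, Pi.add_apply]
  omega

/-- The mutable rows of the matrix are linearly independent. -/
def HasIndependentRows [Fintype N] : Prop :=
  ∀ c : N → ℚ, (∀ j ∈ Q.frozen, c j = 0) → (∀ i, ∑ j, c j * Q.B j i = 0) → c = 0

variable {Q}

theorem HasFullRank.hasIndependentRows [Fintype N] (h : Q.HasFullRank) :
    Q.HasIndependentRows := by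
  classical
  intro c hc hrel
  funext j
  by_cases hj : j ∈ Q.frozen
  · exact hc j hj
  -- Pairing the relation `c` with a preimage `w` of the `j`-th unit vector reads off `c j`.
  obtain ⟨w, hw⟩ := h (Pi.single ⟨j, hj⟩ 1)
  have hw' : ∀ l : {l // l ∉ Q.frozen}, ∑ i, (Q.B l i : ℚ) * w i =
      (Pi.single ⟨j, hj⟩ 1 : {l // l ∉ Q.frozen} → ℚ) l := fun l => congrFun hw l
  have h0 : ∑ i, (∑ l, c l * Q.B l i) * w i = 0 := by simp [hrel]
  have h1 : ∑ i, (∑ l, c l * Q.B l i) * w i = ∑ l, c l * ∑ i, (Q.B l i : ℚ) * w i := by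
    simp only [Finset.sum_mul, Finset.mul_sum]
    rw [Finset.sum_comm]
    simp only [mul_assoc]
  rw [h1, Finset.sum_eq_single j] at h0
  · simpa [hw' ⟨j, hj⟩] using h0
  · intro l _ hl
    by_cases hl' : l ∈ Q.frozen
    · rw [hc l hl', zero_mul]
    · rw [hw' ⟨l, hl'⟩, Pi.single_eq_of_ne (by simpa using hl), mul_zero]
  · simp

/-- Independent rows can be separated by an additive functional. -/
theorem HasIndependentRows.exists_functional [Fintype N] (h : Q.HasIndependentRows) {j k : N}
    (hj : j ∉ Q.frozen) (hk : k ∉ Q.frozen) (hjk : j ≠ k) :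
    ∃ d : (N → ℤ) →+ ℤ, d (Q.B j) = 0 ∧ d (Q.B k) ≠ 0 := by
  classical
  obtain ⟨a, ha⟩ : ∃ a, Q.B j a ≠ 0 := by
    by_contra! hc
    have := congrFun (h (Pi.single j 1) (fun i hi => by
      rw [Pi.single_eq_of_ne]; rintro rfl; exact hj hi) fun i => by simp [Pi.single_apply, hc]) j
    simp at this
  obtain ⟨b, hb⟩ : ∃ b, Q.B j a * Q.B k b - Q.B j b * Q.B k a ≠ 0 := by
    by_contra! hc
    have := congrFun (h (Pi.single k (Q.B j a : ℚ) - Pi.single j (Q.B k a : ℚ)) (fun i hi => by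
      have h1 : i ≠ j := by rintro rfl; exact hj hi
      have h2 : i ≠ k := by rintro rfl; exact hk hi
      simp [h1, h2]) fun i => by
        simp only [Pi.sub_apply, sub_mul, Finset.sum_sub_distrib, Pi.single_apply, ite_mul,
          zero_mul, Finset.sum_ite_eq', Finset.mem_univ, if_true]
        have := hc i
        have h2 : ((Q.B j a * Q.B k i - Q.B j i * Q.B k a : ℤ) : ℚ) = 0 := by rw [this]; simp
        push_cast at h2
        linarith) k
    simp [hjk.symm, ha] at this
  -- The functional is the 2 × 2 minor, in columns `a` and `b`, of row `j` stacked on `u`.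
  refine ⟨{ toFun := fun u => Q.B j a * u b - Q.B j b * u a
            map_zero' := by simp
            map_add' := fun u v => by simp; ring }, ?_, ?_⟩
  · simp only [AddMonoidHom.coe_mk, ZeroHom.coe_mk]
    ring
  · simpa using hb

/-- The quiver with all arrows reversed. -/
def reverse (Q : IceQuiver N) : IceQuiver N where
  B := -Q.B
  skew i j := by simp [Q.skew i j]
  frozen := Q.frozen

theorem HasIndependentRows.reverse [Fintype N] (h : Q.HasIndependentRows) :
    Q.reverse.HasIndependentRows := fun c hc hrel => h c hc fun i => by
  have := hrel i
  simpa [IceQuiver.reverse] using this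

variable [DecidableEq N] (Q)

theorem mutate_B_left (k i : N) : (Q.mutate k).B k i = -Q.B k i := by simp [mutate]

theorem mutate_B_right (k i : N) : (Q.mutate k).B i k = -Q.B i k := by simp [mutate]

theorem mutate_B_of_ne {k i j : N} (hi : i ≠ k) (hj : j ≠ k) :
    (Q.mutate k).B i j = Q.B i j + max (Q.B i k) 0 * max (Q.B k j) 0 -
      max (-Q.B i k) 0 * max (-Q.B k j) 0 := by
  have h : (Q.mutate k).B i j =
      Q.B i j + (|Q.B i k| * Q.B k j + Q.B i k * |Q.B k j|) / 2 := by
    simp [mutate, hi.symm, hj.symm]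
  rw [h, add_sub_assoc]
  congr 1
  refine Int.ediv_eq_of_eq_mul_right two_ne_zero ?_
  rcases le_total 0 (Q.B i k) with h1 | h1 <;> rcases le_total 0 (Q.B k j) with h2 | h2 <;>
    simp [h1, h2, abs_of_nonneg, abs_of_nonpos] <;> ring

@[simp] theorem mutate_frozen (k : N) : (Q.mutate k).frozen = Q.frozen := rfl

@[simp] theorem freeze_B (S : Finset N) : (Q.freeze S).B = Q.B := rfl

@[simp] theorem freeze_frozen (S : Finset N) : (Q.freeze S).frozen = Q.frozen ∪ S := rfl

theorem mutate_mutate (k : N) : (Q.mutate k).mutate k = Q := by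
  refine IceQuiver.ext ?_ rfl
  funext i j
  by_cases hi : i = k
  · subst hi; rw [mutate_B_left, mutate_B_left, neg_neg]
  by_cases hj : j = k
  · subst hj; rw [mutate_B_right, mutate_B_right, neg_neg]
  rw [mutate_B_of_ne _ hi hj, mutate_B_of_ne _ hi hj, mutate_B_right, mutate_B_left]
  simp

theorem posRow_mutate (k : N) : (Q.mutate k).posRow k = Q.negRow k := by
  funext j
  simp [posRow, negRow, mutate_B_left]

theorem negRow_mutate (k : N) : (Q.mutate k).negRow k = Q.posRow k := by
  funext j
  simp [posRow, negRow, mutate_B_left]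

variable {Q}

theorem HasIndependentRows.freeze [Fintype N] (h : Q.HasIndependentRows) (S : Finset N) :
    (Q.freeze S).HasIndependentRows :=
  fun c hc hrel => h c (fun j hj => hc j (by simp [hj])) hrel

/-- Matrix mutation is a row operation followed by a column operation. A relation `c` between the
new rows becomes a relation `c'` between the old ones, changed only at `k`, and `c' = 0` forces `c =
0`. -/
theorem HasIndependentRows.mutate [Fintype N] (h : Q.HasIndependentRows) {k : N}
    (hk : k ∉ Q.frozen) : (Q.mutate k).HasIndependentRows := by
  intro c hc hrel
  set e : ℚ := ∑ j ∈ Finset.univ.erase k, c j * (max (-Q.B j k) 0 : ℤ)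
  let c' : N → ℚ := Function.update c k (-c k + e)
  have hsplit : ∀ g : N → ℚ, ∑ j, g j = g k + ∑ j ∈ Finset.univ.erase k, g j := fun g =>
    (Finset.add_sum_erase _ _ (Finset.mem_univ k)).symm
  have hc'k : c' k = -c k + e := by simp [c']
  have hc'j : ∀ j ∈ Finset.univ.erase k, c' j = c j := fun j hj => by
    simp [c', Finset.ne_of_mem_erase hj]
  -- Column `k` of the relation; it removes the contribution of the column operation in all other
  -- columns.
  have hWk : ∑ j, c' j * Q.B j k = 0 := by
    have := hrel k
    rw [hsplit, mutate_B_right, Q.B_self] at this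
    rw [hsplit, Q.B_self]
    simp only [mutate_B_right, neg_zero, Int.cast_zero, mul_zero, zero_add, Int.cast_neg, mul_neg,
      Finset.sum_neg_distrib, neg_eq_zero] at this
    rw [Int.cast_zero, mul_zero, zero_add, ← this]
    exact Finset.sum_congr rfl fun j hj => by rw [hc'j j hj]
  have hW : ∀ i, ∑ j, c' j * Q.B j i = 0 := by
    intro i
    by_cases hi : i = k
    · rw [hi, hWk]
    have h1 := hrel i
    rw [hsplit, mutate_B_left] at h1
    rw [hsplit, Q.B_self, Int.cast_zero, mul_zero, zero_add] at hWk
    rw [hsplit, hc'k]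
    have h2 : ∑ j ∈ Finset.univ.erase k, c j * ((Q.mutate k).B j i : ℚ) =
        ∑ j ∈ Finset.univ.erase k, c' j * Q.B j i + e * Q.B k i +
          (∑ j ∈ Finset.univ.erase k, c' j * Q.B j k) * (max (Q.B k i) 0 : ℤ) := by
      rw [Finset.sum_mul, Finset.sum_mul, ← Finset.sum_add_distrib, ← Finset.sum_add_distrib]
      refine Finset.sum_congr rfl fun j hj => ?_
      rw [hc'j j hj, mutate_B_of_ne _ (Finset.ne_of_mem_erase hj) hi]
      have : ((Q.B j i + max (Q.B j k) 0 * max (Q.B k i) 0 -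
          max (-Q.B j k) 0 * max (-Q.B k i) 0 : ℤ) : ℚ) =
          ((Q.B j i + max (-Q.B j k) 0 * Q.B k i + Q.B j k * max (Q.B k i) 0 : ℤ) : ℚ) := by
        congr 1
        have e1 : max (Q.B j k) 0 = Q.B j k + max (-Q.B j k) 0 := by omega
        have e2 : max (Q.B k i) 0 = Q.B k i + max (-Q.B k i) 0 := by omega
        rw [e1, e2]
        ring
      rw [this]
      push_cast
      ring
    rw [h2, hWk] at h1
    push_cast at h1 ⊢
    linarith
  have hc' : c' = 0 := h c' (fun j hj => by
    have : j ≠ k := by rintro rfl; exact hk hj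
    simpa [c', this] using hc j (by simpa using hj)) hW
  have hcj : ∀ j, j ≠ k → c j = 0 := fun j hj => by
    have := congrFun hc' j
    simpa [c', hj] using this
  funext j
  by_cases hj : j = k
  · have he : e = 0 := Finset.sum_eq_zero fun j hj => by
      rw [hcj j (Finset.ne_of_mem_erase hj), zero_mul]
    have := congrFun hc' k
    rw [hc'k, he, add_zero] at this
    simpa [hj] using this
  · exact hcj j hj

theorem mutate_reverse (k : N) : Q.reverse.mutate k = (Q.mutate k).reverse := by
  refine IceQuiver.ext ?_ rfl
  funext i j
  change _ = -(Q.mutate k).B i j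
  by_cases hi : i = k
  · subst hi; rw [mutate_B_left, mutate_B_left]; rfl
  by_cases hj : j = k
  · subst hj; rw [mutate_B_right, mutate_B_right]; rfl
  rw [mutate_B_of_ne _ hi hj, mutate_B_of_ne _ hi hj]
  simp only [reverse, Matrix.neg_apply, neg_neg]
  ring

end IceQuiver

/-! ### Algebraic independence by counting -/

universe u

/-- The field has transcendence degree |N| and `x` is a transcendence basis, so it is algebraic over
ℚ(y); at most |N| elements can achieve this only if they are independent. -/
theorem algebraicIndependent_of_isAlgebraic {N ι : Type u} [Fintype N] [Fintype ι]
    {x : N → RatFunField N} (hx : AlgebraicIndependent ℚ x) {y : ι → RatFunField N}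
    (hcard : Fintype.card ι ≤ Fintype.card N)
    (hy : ∀ i, IsAlgebraic (IntermediateField.adjoin ℚ (Set.range y)) (x i)) :
    AlgebraicIndependent ℚ y := by
  open IntermediateField.algebraAdjoinAdjoin in
  have : Algebra.IsAlgebraic (MvPolynomial N ℚ) (RatFunField N) :=
    IsLocalization.isAlgebraic _ (nonZeroDivisors (MvPolynomial N ℚ))
  have hbasis : IsTranscendenceBasis ℚ
      (algebraMap (MvPolynomial N ℚ) (RatFunField N) ∘ MvPolynomial.X) :=
    (IsTranscendenceBasis.mvPolynomial N ℚ).algebraMap_comp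
  have htr := hbasis.cardinalMk_eq_trdeg
  have hxb : IsTranscendenceBasis ℚ x :=
    hx.isTranscendenceBasis_of_trdeg_le_of_finite htr.ge
  set E := IntermediateField.adjoin ℚ (Set.range y)
  have halg : Algebra.IsAlgebraic E (RatFunField N) := by
    have h1 := hxb.isAlgebraic_field
    let C := algebraicClosure E (RatFunField N)
    have hle : IntermediateField.adjoin ℚ (Set.range x) ≤ C.restrictScalars ℚ := by
      rw [IntermediateField.adjoin_le_iff]
      rintro _ ⟨i, rfl⟩
      exact mem_algebraicClosure_iff.mpr (hy i)
    have h2 : Algebra.IsAlgebraic C (RatFunField N) := by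
      refine ⟨fun z => ?_⟩
      let _ := (IntermediateField.inclusion hle).toAlgebra
      have : IsScalarTower (IntermediateField.adjoin ℚ (Set.range x)) (C.restrictScalars ℚ)
        (RatFunField N) := IsScalarTower.of_algebraMap_eq fun _ => rfl
      exact (h1.isAlgebraic z).tower_top (C.restrictScalars ℚ)
    exact Algebra.IsAlgebraic.trans E C (RatFunField N)
  have halg' : Algebra.IsAlgebraic (Algebra.adjoin ℚ (Set.range y)) (RatFunField N) :=
    (IsFractionRing.comap_isAlgebraic_iff (A := Algebra.adjoin ℚ (Set.range y)) (K := E)).mpr halg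
  refine (Algebra.IsAlgebraic.isTranscendenceBasis_of_le_trdeg_of_finite ℚ y ?_).1
  rw [← htr]
  simpa using hcard

/-! ### Seeds -/

namespace ClusterSeed

variable {N : Type u}

section Freeze

variable [DecidableEq N]

@[simp] theorem freeze_quiver (s : ClusterSeed N) (S : Finset N) :
    (s.freeze S).quiver = s.quiver.freeze S := rfl

@[simp] theorem freeze_cluster (s : ClusterSeed N) (S : Finset N) :
    (s.freeze S).cluster = s.cluster := rfl

end Freeze

variable [Fintype N]

/-- The numerator of the exchange relation at `k`. -/
noncomputable def exchange (s : ClusterSeed N) (k : N) : RatFunField N :=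
  laurentMonomial s.cluster (s.quiver.posRow k) + laurentMonomial s.cluster (s.quiver.negRow k)

/-- The cluster is algebraically independent and the exchange matrix has independent rows. -/
structure IsNondegenerate (s : ClusterSeed N) : Prop where
  algebraicIndependent : AlgebraicIndependent ℚ s.cluster
  hasIndependentRows : s.quiver.HasIndependentRows

open AddMonoidAlgebra in
/-- The numerator of the exchange relation at `k` as a formal Laurent polynomial. -/
noncomputable def exchangePolynomial (s : ClusterSeed N) (k : N) : AddMonoidAlgebra ℚ (N → ℤ) :=
  single (s.quiver.posRow k) 1 + single (s.quiver.negRow k) 1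

variable {s : ClusterSeed N}

theorem laurentEval_exchangePolynomial (h : ∀ i, s.cluster i ≠ 0) (k : N) :
    laurentEval s.cluster h (s.exchangePolynomial k) = s.exchange k := by
  rw [exchangePolynomial, map_add, laurentEval_single_one, laurentEval_single_one, exchange]

theorem exchangePolynomial_coeff_ne_zero {k : N} {v : N → ℤ}
    (h : (s.exchangePolynomial k).coeff v ≠ 0) :
    v = s.quiver.posRow k ∨ v = s.quiver.negRow k := by
  classical
  by_contra! hc
  exact h (by simp [exchangePolynomial, hc.1.symm, hc.2.symm])

theorem exchangePolynomial_ne_zero (s : ClusterSeed N) (k : N) : s.exchangePolynomial k ≠ 0 := by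
  classical
  intro h
  have h1 := congrArg (fun F => F.coeff (s.quiver.posRow k)) h
  by_cases h2 : s.quiver.negRow k = s.quiver.posRow k <;>
    simp [exchangePolynomial, h2] at h1

theorem exchange_eq_mul (h : ∀ i, s.cluster i ≠ 0) (k : N) :
    s.exchange k = laurentMonomial s.cluster (s.quiver.negRow k) *
      (1 + laurentMonomial s.cluster (s.quiver.B k)) := by
  rw [exchange, s.quiver.posRow_eq_add, laurentMonomial.add h]
  ring

namespace IsNondegenerate

theorem cluster_ne_zero (h : s.IsNondegenerate) (i : N) : s.cluster i ≠ 0 :=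
  h.algebraicIndependent.ne_zero i

theorem exchange_ne_zero (h : s.IsNondegenerate) (k : N) : s.exchange k ≠ 0 := by
  rw [← laurentEval_exchangePolynomial h.cluster_ne_zero]
  exact fun h0 => s.exchangePolynomial_ne_zero k
    (h.algebraicIndependent.laurentEval_injective (by rw [h0, map_zero]))

/-- Full rank enters the coprimality here. Only the exponents matter, so `x` may be any independent
family, in particular a cluster other than that of `s`. -/
theorem coprimeIn_one_add (h : s.IsNondegenerate) {j k : N} (hj : j ∉ s.quiver.frozen)
    (hk : k ∉ s.quiver.frozen) (hjk : j ≠ k) {x : N → RatFunField N}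
    (hx : AlgebraicIndependent ℚ x) :
    (laurentAlgebra x).CoprimeIn (1 + laurentMonomial x (s.quiver.B j))
      (1 + laurentMonomial x (s.quiver.B k)) := by
  obtain ⟨d, h1, h2⟩ := h.hasIndependentRows.exists_functional hj hk hjk
  exact hx.coprimeIn_laurentAlgebra d h1 h2

end IsNondegenerate

variable [DecidableEq N]

theorem mutate_cluster (s : ClusterSeed N) (k : N) :
    (s.mutate k).cluster = Function.update s.cluster k (s.exchange k / s.cluster k) := by
  funext i
  by_cases hi : i = k
  · subst hi
    simp only [mutate, if_true, Function.update_self, exchange, laurentMonomial, div_eq_mul_inv,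
      IceQuiver.posRow, IceQuiver.negRow]
    congr 2 <;> refine Finset.prod_congr rfl fun j _ => ?_ <;>
      rw [← zpow_natCast, Int.toNat_eq_max]
  · simp [mutate, hi]

@[simp] theorem mutate_quiver (s : ClusterSeed N) (k : N) :
    (s.mutate k).quiver = s.quiver.mutate k := rfl

theorem mutate_cluster_self (s : ClusterSeed N) (k : N) :
    (s.mutate k).cluster k = s.exchange k / s.cluster k := by
  rw [mutate_cluster, Function.update_self]

theorem mutate_cluster_of_ne (s : ClusterSeed N) {k i : N} (h : i ≠ k) :
    (s.mutate k).cluster i = s.cluster i := by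
  rw [mutate_cluster, Function.update_of_ne h]

/-- Mutation at `k` interchanges the two exchange monomials, and neither involves the variable at
`k`. This is why seed mutation is an involution. -/
theorem exchange_mutate_self (s : ClusterSeed N) (k : N) :
    (s.mutate k).exchange k = s.exchange k := by
  have h : ∀ v : N → ℤ, v k = 0 →
      laurentMonomial (s.mutate k).cluster v = laurentMonomial s.cluster v := by
    intro v hv
    refine Finset.prod_congr rfl fun i _ => ?_
    by_cases hi : i = k
    · rw [hi, hv, zpow_zero, zpow_zero]
    · rw [mutate_cluster_of_ne _ hi]
  rw [exchange, exchange, mutate_quiver, IceQuiver.posRow_mutate, IceQuiver.negRow_mutate, add_comm,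
    h, h] <;> simp [IceQuiver.posRow, IceQuiver.negRow, IceQuiver.B_self]

namespace IsNondegenerate

theorem mutate_mutate (h : s.IsNondegenerate) (k : N) : (s.mutate k).mutate k = s := by
  refine ClusterSeed.ext (s.quiver.mutate_mutate k) ?_
  rw [mutate_cluster, exchange_mutate_self, mutate_cluster_self, mutate_cluster,
    Function.update_idem, div_div_cancel₀ (h.exchange_ne_zero k), Function.update_eq_self]

theorem freeze (h : s.IsNondegenerate) (S : Finset N) : (s.freeze S).IsNondegenerate :=
  ⟨h.1, h.2.freeze S⟩

theorem mutate (h : s.IsNondegenerate) {k : N} (hk : k ∉ s.quiver.frozen) :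
    (s.mutate k).IsNondegenerate := by
  refine ⟨algebraicIndependent_of_isAlgebraic h.1 le_rfl fun i => ?_, h.2.mutate hk⟩
  set E := IntermediateField.adjoin ℚ (Set.range (s.mutate k).cluster)
  have hE : ∀ i, (s.mutate k).cluster i ∈ E := fun i =>
    IntermediateField.subset_adjoin _ _ ⟨i, rfl⟩
  have hmem : s.cluster i ∈ E := by
    by_cases hi : i = k
    · subst hi
      have h1 : s.cluster i = (s.mutate i).exchange i / (s.mutate i).cluster i := by
        rw [exchange_mutate_self, mutate_cluster_self, div_div_cancel₀ (h.exchange_ne_zero i)]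
      rw [h1]
      exact E.div_mem (E.add_mem (prod_mem fun j _ => zpow_mem (hE j) _)
        (prod_mem fun j _ => zpow_mem (hE j) _)) (hE i)
    · rw [← mutate_cluster_of_ne s hi]
      exact hE i
  exact isAlgebraic_algebraMap (⟨s.cluster i, hmem⟩ : E)

end IsNondegenerate

namespace MutationEquiv

variable {t u : ClusterSeed N}

theorem frozen_eq (h : s.MutationEquiv t) : t.quiver.frozen = s.quiver.frozen := by
  induction h with
  | refl => rfl
  | tail _ hbc ih => obtain ⟨k, _, rfl⟩ := hbc; exact ih

theorem isNondegenerate (h : s.MutationEquiv t) (hs : s.IsNondegenerate) : t.IsNondegenerate := by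
  induction h with
  | refl => exact hs
  | tail _ hbc ih => obtain ⟨k, hk, rfl⟩ := hbc; exact ih.mutate hk

theorem symm (h : s.MutationEquiv t) (hs : s.IsNondegenerate) : t.MutationEquiv s := by
  induction h with
  | refl => exact .refl
  | tail hab hbc ih =>
    obtain ⟨k, hk, rfl⟩ := hbc
    exact .head ⟨k, hk, ((isNondegenerate hab hs).mutate_mutate k).symm⟩ ih

theorem cluster_eq_of_mem_frozen (h : s.MutationEquiv t) {i : N} (hi : i ∈ s.quiver.frozen) :
    t.cluster i = s.cluster i := by
  induction h with
  | refl => rfl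
  | tail hab hbc ih =>
    obtain ⟨k, hk, rfl⟩ := hbc
    rw [← ih, mutate_cluster_of_ne]
    rintro rfl
    exact hk (frozen_eq hab ▸ hi)

/-- A mutation sequence of a freezing is a mutation sequence of the original seed. -/
theorem exists_eq_freeze {S : Finset N} (h : (s.freeze S).MutationEquiv t) :
    ∃ u, s.MutationEquiv u ∧ t = u.freeze S := by
  induction h with
  | refl => exact ⟨s, .refl, rfl⟩
  | tail _ hbc ih =>
    obtain ⟨u, hu, rfl⟩ := ih
    obtain ⟨k, hk, rfl⟩ := hbc
    exact ⟨u.mutate k, .tail hu ⟨k, fun hk' => hk (by simp [hk']), rfl⟩, rfl⟩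

end MutationEquiv

/-- Elements which are Laurent polynomials in the clusters adjacent to `s` along pairwise
unconnected mutable vertices are polynomials in the exchanged variables. -/
theorem IsNondegenerate.mem_of_forall_mem_laurentAlgebra (h : s.IsNondegenerate) (I : Finset N)
    (hI : ∀ k ∈ I, k ∉ s.quiver.frozen) (hB : ∀ k ∈ I, ∀ l ∈ I, s.quiver.B k l = 0)
    {f : RatFunField N} (hf : f ∈ laurentAlgebra s.cluster)
    (hfI : ∀ k ∈ I, f ∈ laurentAlgebra (s.mutate k).cluster)
    {L : Subalgebra ℚ (RatFunField N)} (h1 : ∀ i, s.cluster i ∈ L)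
    (h2 : ∀ i ∉ I, (s.cluster i)⁻¹ ∈ L) (h3 : ∀ k ∈ I, (s.mutate k).cluster k ∈ L) : f ∈ L := by
  refine h.algebraicIndependent.mem_of_forall_mem_laurentAlgebra I s.exchangePolynomial
    (fun k _ => s.exchangePolynomial_ne_zero k) ?_ ?_ hf ?_ h1 h2 ?_
  · intro k hk v hv i hi
    rcases exchangePolynomial_coeff_ne_zero hv with rfl | rfl <;>
      simp [IceQuiver.posRow, IceQuiver.negRow, hB k hk i hi]
  · intro k hk l hl hkl
    rw [laurentEval_exchangePolynomial, laurentEval_exchangePolynomial,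
      exchange_eq_mul h.cluster_ne_zero, exchange_eq_mul h.cluster_ne_zero]
    refine Subalgebra.CoprimeIn.unit_mul_unit_mul (laurentMonomial.ne_zero h.cluster_ne_zero _) ?_
      (laurentMonomial.ne_zero h.cluster_ne_zero _) ?_
      (h.coprimeIn_one_add (hI k hk) (hI l hl) hkl h.1)
    · rw [← laurentMonomial.neg]; exact laurentAlgebra.monomial_mem _ _
    · rw [← laurentMonomial.neg]; exact laurentAlgebra.monomial_mem _ _
  · intro k hk
    rw [laurentEval_exchangePolynomial, ← mutate_cluster]
    exact hfI k hk
  · intro k hk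
    rw [laurentEval_exchangePolynomial, ← mutate_cluster_self]
    exact h3 k hk

end ClusterSeed

/-! ### The upper cluster algebra is invariant under mutation -/

namespace Subalgebra

variable {k K : Type*} [Field k] [Field K] [Algebra k K]

/-- The elements which some power of `p` multiplies into `A`. -/
def away (A : Subalgebra k K) (p : K) (hp : p ∈ A) : Subalgebra k K where
  carrier := {f | ∃ n : ℕ, p ^ n * f ∈ A}
  mul_mem' := by
    rintro f g ⟨m, hm⟩ ⟨n, hn⟩
    refine ⟨m + n, ?_⟩
    have : p ^ (m + n) * (f * g) = p ^ m * f * (p ^ n * g) := by ring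
    rw [this]
    exact mul_mem hm hn
  add_mem' := by
    rintro f g ⟨m, hm⟩ ⟨n, hn⟩
    refine ⟨m + n, ?_⟩
    have : p ^ (m + n) * (f + g) = p ^ n * (p ^ m * f) + p ^ m * (p ^ n * g) := by ring
    rw [this]
    exact add_mem (mul_mem (pow_mem hp _) hm) (mul_mem (pow_mem hp _) hn)
  algebraMap_mem' r := ⟨0, by simp⟩

variable {A : Subalgebra k K} {p : K} {hp : p ∈ A}

theorem le_away : A ≤ A.away p hp := fun f hf => ⟨0, by simpa using hf⟩

theorem mem_away_of_mul_mem {f : K} (h : p * f ∈ A) : f ∈ A.away p hp := ⟨1, by simpa using h⟩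

/-- In other words A[1/p] ∩ A[1/q] = A, the gluing device both for two successive mutations and for
acyclic seeds. -/
theorem CoprimeIn.mem_of_mem_away {q f : K} {hq : q ∈ A} (h : A.CoprimeIn p q)
    (h1 : f ∈ A.away p hp) (h2 : f ∈ A.away q hq) : f ∈ A := by
  obtain ⟨m, hm⟩ := h1
  obtain ⟨n, hn⟩ := h2
  exact h.pow_pow hp hq m n f (by rwa [mul_comm]) (by rwa [mul_comm])

end Subalgebra

theorem exists_one_add_mul_pow_eq {R : Type*} [CommRing R] {S : Subring R} {a w : R}
    (ha : a ∈ S) (hw : w ∈ S) (n : ℕ) : ∃ q ∈ S, (1 + a * w) ^ n = 1 + a * q := by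
  induction n with
  | zero => exact ⟨0, zero_mem _, by simp⟩
  | succ n ih =>
    obtain ⟨q, hq, h⟩ := ih
    exact ⟨q + w + a * w * q, add_mem (add_mem hq hw) (mul_mem (mul_mem ha hw) hq), by
      rw [pow_succ, h]; ring⟩

theorem laurentMonomial_congr {N K : Type*} [Fintype N] [Field K] {x y : N → K} {v : N → ℤ}
    (h : ∀ i, v i ≠ 0 → x i = y i) : laurentMonomial x v = laurentMonomial y v := by
  refine Finset.prod_congr rfl fun i _ => ?_
  by_cases hi : v i = 0
  · simp [hi]
  · rw [h i hi]

namespace ClusterSeed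

section Reverse

variable {N : Type u}

/-- The seed with the opposite quiver. -/
def reverse (s : ClusterSeed N) : ClusterSeed N := ⟨s.quiver.reverse, s.cluster⟩

variable [Fintype N] {s : ClusterSeed N}

theorem IsNondegenerate.reverse (h : s.IsNondegenerate) : s.reverse.IsNondegenerate :=
  ⟨h.1, h.2.reverse⟩

theorem exchange_reverse (s : ClusterSeed N) (k : N) : s.reverse.exchange k = s.exchange k := by
  have h : s.quiver.reverse.negRow k = s.quiver.posRow k := by
    funext j
    simp [IceQuiver.posRow, IceQuiver.negRow, IceQuiver.reverse]
  rw [exchange, exchange, add_comm, reverse, h]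
  rfl

theorem mutate_reverse [DecidableEq N] (s : ClusterSeed N) (k : N) :
    s.reverse.mutate k = (s.mutate k).reverse := by
  refine ClusterSeed.ext (s.quiver.mutate_reverse k) ?_
  rw [mutate_cluster, exchange_reverse]
  exact (mutate_cluster s k).symm

end Reverse

variable {N : Type u} [Fintype N] [DecidableEq N] {s : ClusterSeed N}

section TwoMutations

variable {j k : N}

/-- The case of two adjacent mutable vertices. -/
theorem IsNondegenerate.mem_laurentAlgebra_of_pos (h : s.IsNondegenerate)
    (hj : j ∉ s.quiver.frozen) (hk : k ∉ s.quiver.frozen) (hB : 0 < s.quiver.B j k)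
    {f : RatFunField N} (hf : f ∈ laurentAlgebra s.cluster)
    (hfj : f ∈ laurentAlgebra (s.mutate j).cluster)
    (hfk : f ∈ laurentAlgebra (s.mutate k).cluster) :
    f ∈ laurentAlgebra ((s.mutate k).mutate j).cluster := by
  have hjk : j ≠ k := by rintro rfl; rw [s.quiver.B_self] at hB; exact lt_irrefl _ hB
  set x := s.cluster with hx
  set s' := s.mutate k with hs'
  set x' := s'.cluster with hx'
  set x'' := (s'.mutate j).cluster with hx''
  have hx0 : ∀ i, x i ≠ 0 := h.cluster_ne_zero
  have hs'n : s'.IsNondegenerate := h.mutate hk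
  have hx'0 : ∀ i, x' i ≠ 0 := hs'n.cluster_ne_zero
  have hBkj : s.quiver.B k j = -s.quiver.B j k := s.quiver.skew k j
  obtain ⟨b, hb⟩ : ∃ b : ℕ, s.quiver.B j k = b + 1 := ⟨(s.quiver.B j k - 1).toNat, by omega⟩
  set T := laurentAlgebra x'' with hT
  have hx'k : x' k = s.exchange k / x k := mutate_cluster_self s k
  have hx'i : ∀ i, i ≠ k → x' i = x i := fun i hi => mutate_cluster_of_ne s hi
  have hx''j : x'' j = s'.exchange j / x j := by
    rw [hx'', mutate_cluster_self, ← hx', hx'i j hjk]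
  have hx''i : ∀ i, i ≠ j → x'' i = x' i := fun i hi => mutate_cluster_of_ne s' hi
  have hx''x : ∀ i, i ≠ j → i ≠ k → x'' i = x i := fun i h1 h2 => by rw [hx''i i h1, hx'i i h2]
  -- monomials not involving `j`
  have hmon' : ∀ v : N → ℤ, v j = 0 → laurentMonomial x' v ∈ T := fun v hv => by
    rw [laurentMonomial_congr (y := x'') fun i hi => (hx''i i (by rintro rfl; exact hi hv)).symm]
    exact laurentAlgebra.monomial_mem _ _
  have hmon : ∀ v : N → ℤ, v j = 0 → v k = 0 → laurentMonomial x v ∈ T := fun v hv hv' => by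
    rw [laurentMonomial_congr (y := x') fun i hi => (hx'i i (by rintro rfl; exact hi hv')).symm]
    exact hmon' v hv
  have hex' : s'.exchange j ∈ T := add_mem
    (hmon' _ (by simp [IceQuiver.posRow, IceQuiver.B_self]))
    (hmon' _ (by simp [IceQuiver.negRow, IceQuiver.B_self]))
  have hxjT : x j ∈ T := by
    have : x j = s'.exchange j * (x'' j)⁻¹ := by
      rw [hx''j, inv_div, mul_div_cancel₀ _ (hs'n.exchange_ne_zero j)]
    rw [this]
    exact mul_mem hex' (laurentAlgebra.inv_mem _ _)
  -- the exchange polynomial at `k`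
  set M := laurentMonomial x (s.quiver.posRow k) with hM
  have hM0 : M ≠ 0 := laurentMonomial.ne_zero hx0 _
  have hposk : s.quiver.posRow k k = 0 := by simp [IceQuiver.posRow, IceQuiver.B_self]
  have hposj : s.quiver.posRow k j = 0 := by simp only [IceQuiver.posRow]; omega
  have hMinv : M⁻¹ ∈ T := by
    rw [hM, ← laurentMonomial.neg]
    exact hmon _ (by simp [hposj]) (by simp [hposk])
  -- As `B k j < 0`, only the negative monomial contains `x j`. Divided by the unit `M`, the
  -- exchange numerator at `k` is therefore 1 modulo `x j`.
  obtain ⟨w, hwT, hw⟩ : ∃ w ∈ T, s.exchange k / M = 1 + x j * w := by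
    refine ⟨x j ^ b * (laurentMonomial x (s.quiver.negRow k - Pi.single j ((b : ℤ) + 1)) * M⁻¹),
      mul_mem (pow_mem hxjT _) (mul_mem (hmon _ ?_ ?_) hMinv), ?_⟩
    · simp only [IceQuiver.negRow, Pi.sub_apply, Pi.single_eq_same]; omega
    · simp [IceQuiver.negRow, hjk.symm, IceQuiver.B_self]
    · have : laurentMonomial x (s.quiver.negRow k) =
          x j ^ (b + 1) * laurentMonomial x (s.quiver.negRow k - Pi.single j ((b : ℤ) + 1)) := by
        rw [← zpow_natCast, ← laurentMonomial.single, ← laurentMonomial.add hx0]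
        congr 1
        push_cast
        abel
      rw [exchange, ← hx, ← hM, this, add_div, div_self hM0]
      field_simp
      ring
  have hexk : s.exchange k = M * (1 + x j * w) := by rw [← hw, mul_div_cancel₀ _ hM0]
  have hMT : M ∈ T := hmon _ hposj hposk
  have hexkT : s.exchange k ∈ T := by
    rw [hexk]
    exact mul_mem hMT (add_mem (one_mem _) (mul_mem hxjT hwT))
  have hx'kT : x' k ∈ T := by rw [← hx''i k hjk.symm]; exact laurentAlgebra.var_mem _ _
  have hx'kT' : (x' k)⁻¹ ∈ T := by rw [← hx''i k hjk.symm]; exact laurentAlgebra.inv_mem _ _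
  have hxkT : x k ∈ T := by
    have : x k = s.exchange k * (x' k)⁻¹ := by
      rw [hx'k, inv_div, mul_div_cancel₀ _ (h.exchange_ne_zero k)]
    rw [this]
    exact mul_mem hexkT hx'kT'
  have hxiT : ∀ i, x i ∈ T := fun i => by
    by_cases h1 : i = j
    · rwa [h1]
    by_cases h2 : i = k
    · rwa [h2]
    rw [← hx''x i h1 h2]
    exact laurentAlgebra.var_mem _ _
  have hxiT' : ∀ i, i ≠ j → i ≠ k → (x i)⁻¹ ∈ T := fun i h1 h2 => by
    rw [← hx''x i h1 h2]
    exact laurentAlgebra.inv_mem _ _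
  -- comparison of the exchange polynomials at `j`
  have hy : laurentMonomial x (s.quiver.B j) =
      laurentMonomial x' (s'.quiver.B j) * (s.exchange k / M) ^ (b + 1) := by
    have h1 : Function.update (s'.quiver.B j) k (-(s'.quiver.B j k)) =
        s.quiver.B j + (b + 1) • s.quiver.posRow k := by
      funext i
      by_cases hik : i = k
      · subst hik
        simp [hs', IceQuiver.mutate_B_right, hposk]
      · have : max (-s.quiver.B j k) 0 = 0 := by omega
        have h3 : max (s.quiver.B j k) 0 = b + 1 := by omega
        simp [hik, hs', IceQuiver.mutate_B_of_ne _ hjk hik, this, h3, IceQuiver.posRow]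
    have h2 : s'.quiver.B j k = -((b + 1 : ℕ) : ℤ) := by
      rw [hs', mutate_quiver, IceQuiver.mutate_B_right, hb]
      push_cast
      rfl
    rw [hx', hs', mutate_cluster, laurentMonomial.update hx0 (h.exchange_ne_zero k), ← hs', h1,
      laurentMonomial.add hx0, laurentMonomial.nsmul hx0, h2, zpow_neg, zpow_natCast, div_pow]
    have := h.exchange_ne_zero k
    field_simp
    rw [← hM]
  have hy' : 1 + laurentMonomial x' (s'.quiver.B j) =
      x j * (x'' j * laurentMonomial x' (-s'.quiver.negRow j)) := by
    rw [hx''j, laurentMonomial.neg, exchange_eq_mul hx'0]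
    have := laurentMonomial.ne_zero hx'0 (s'.quiver.negRow j)
    have := hx0 j
    field_simp
    rw [← hx']
    ring
  -- By `hy` and `hw`, 1 + x^(B j) is congruent modulo `x j` in `T` to 1 + x'^(B' j), which by `hy'`
  -- is itself a multiple of `x j`. So the division by `x j` in the exchange relation stays in `T`.
  have hxj'T : (s.mutate j).cluster j ∈ T := by
    obtain ⟨q, hq, hqe⟩ := exists_one_add_mul_pow_eq (S := T.toSubring) hxjT hwT (b + 1)
    have hqT : q ∈ T := hq
    have : (s.mutate j).cluster j = laurentMonomial x (s.quiver.negRow j) *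
        (x'' j * laurentMonomial x' (-s'.quiver.negRow j) +
          laurentMonomial x' (s'.quiver.B j) * q) := by
      rw [mutate_cluster_self, exchange_eq_mul hx0, ← hx, hy, hw, hqe, div_eq_iff (hx0 j)]
      linear_combination laurentMonomial x (s.quiver.negRow j) * hy'
    rw [this]
    refine mul_mem (laurentMonomial_mem (fun i _ => hxiT i) fun i hi => absurd hi ?_)
      (add_mem (mul_mem (laurentAlgebra.var_mem _ _) (hmon' _ ?_)) (mul_mem (hmon' _ ?_) hqT))
    · simp [IceQuiver.negRow]
    · simp [IceQuiver.negRow, IceQuiver.B_self]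
    · simp [IceQuiver.B_self]
  -- conclusion
  have hf1 : f ∈ T.away (s.exchange k) hexkT := by
    refine h.mem_of_forall_mem_laurentAlgebra {j} (by simpa using hj)
      (by simp [IceQuiver.B_self]) hf (by simpa using hfj)
      (fun i => Subalgebra.le_away (hxiT i)) (fun i hi => ?_)
      (by simpa using Subalgebra.le_away hxj'T)
    rw [Finset.mem_singleton] at hi
    by_cases hik : i = k
    · subst hik
      refine Subalgebra.mem_away_of_mul_mem ?_
      rw [← hx, ← div_eq_mul_inv, ← hx'k]
      exact hx'kT
    · exact Subalgebra.le_away (hxiT' i hi hik)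
  have hf2 : f ∈ T.away (x j) hxjT := by
    suffices hle : laurentAlgebra x' ≤ T.away (x j) hxjT from hle hfk
    refine laurentAlgebra.le_of_mem (fun i => Subalgebra.le_away ?_) fun i => ?_
    · by_cases h1 : i = j
      · rw [h1, hx'i j hjk]; exact hxjT
      · rw [← hx''i i h1]; exact laurentAlgebra.var_mem _ _
    · by_cases h1 : i = j
      · refine Subalgebra.mem_away_of_mul_mem ?_
        rw [h1, hx'i j hjk, mul_inv_cancel₀ (hx0 j)]
        exact one_mem _
      · rw [← hx''i i h1]; exact Subalgebra.le_away (laurentAlgebra.inv_mem _ _)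
  -- Inverting the exchange numerator at `k` makes `x k` a unit; inverting `x j` brings in all
  -- Laurent polynomials in `x'`. The inverted elements are comaximal in `T`, so `f` lies in `T`.
  refine Subalgebra.CoprimeIn.mem_of_mem_away
    (.of_add_eq_one (a := M⁻¹) (b := -w) hMinv (neg_mem hwT) ?_) hf1 hf2
  rw [hexk]
  field_simp
  ring

/-- The case of two mutable vertices which are not adjacent. -/
theorem IsNondegenerate.mem_laurentAlgebra_of_eq_zero (h : s.IsNondegenerate)
    (hj : j ∉ s.quiver.frozen) (hk : k ∉ s.quiver.frozen) (hjk : j ≠ k) (hB : s.quiver.B j k = 0)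
    {f : RatFunField N}
    (hfj : f ∈ laurentAlgebra (s.mutate j).cluster)
    (hfk : f ∈ laurentAlgebra (s.mutate k).cluster) :
    f ∈ laurentAlgebra ((s.mutate k).mutate j).cluster := by
  set x := s.cluster with hx
  set s' := s.mutate k with hs'
  set x' := s'.cluster with hx'
  set x'' := (s'.mutate j).cluster with hx''
  have hx0 : ∀ i, x i ≠ 0 := h.cluster_ne_zero
  have hs'n : s'.IsNondegenerate := h.mutate hk
  have hs''n : (s'.mutate j).IsNondegenerate := hs'n.mutate hj
  have hBkj : s.quiver.B k j = 0 := by rw [s.quiver.skew, hB, neg_zero]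
  set T := laurentAlgebra x'' with hT
  have hx'k : x' k = s.exchange k / x k := mutate_cluster_self s k
  have hx'i : ∀ i, i ≠ k → x' i = x i := fun i hi => mutate_cluster_of_ne s hi
  have hx''i : ∀ i, i ≠ j → x'' i = x' i := fun i hi => mutate_cluster_of_ne s' hi
  have hmon : ∀ v : N → ℤ, v j = 0 → v k = 0 →
      laurentMonomial x v = laurentMonomial x'' v := fun v hv hv' =>
    laurentMonomial_congr fun i hi => by
      rw [hx''i i (by rintro rfl; exact hi hv), hx'i i (by rintro rfl; exact hi hv')]
  -- Without arrows between `j` and `k`, neither exchange numerator involves `x j` or `x k`; both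
  -- can be computed in `x''`.
  have hrow : s'.quiver.B j = s.quiver.B j := by
    funext i
    by_cases hik : i = k
    · subst hik
      rw [hs', mutate_quiver, IceQuiver.mutate_B_right, hB, neg_zero]
    · rw [hs', mutate_quiver, IceQuiver.mutate_B_of_ne _ hjk hik, hB]
      simp
  have hexj : s'.exchange j = s.exchange j := by
    have h1 : ∀ v : N → ℤ, v k = 0 → laurentMonomial x' v = laurentMonomial x v := fun v hv =>
      laurentMonomial_congr fun i hi => hx'i i (by rintro rfl; exact hi hv)
    have h2 : s'.quiver.posRow j = s.quiver.posRow j := by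
      funext i; simp only [IceQuiver.posRow, hrow]
    have h3 : s'.quiver.negRow j = s.quiver.negRow j := by
      funext i; simp only [IceQuiver.negRow, hrow]
    rw [exchange, exchange, h2, h3, ← hx', h1, h1] <;>
      simp [IceQuiver.posRow, IceQuiver.negRow, hB]
  have hx''j : x'' j = s.exchange j / x j := by
    rw [hx'', mutate_cluster_self, ← hx', hx'i j hjk, hexj]
  have hx''k : x'' k = s.exchange k / x k := by rw [hx''i k hjk.symm, hx'k]
  have hform : ∀ l, s.quiver.B l j = 0 → s.quiver.B l k = 0 →
      s.exchange l = laurentMonomial x'' (s.quiver.negRow l) *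
        (1 + laurentMonomial x'' (s.quiver.B l)) := fun l h1 h2 => by
    rw [exchange_eq_mul hx0, hmon _ (by simp [IceQuiver.negRow, h1])
      (by simp [IceQuiver.negRow, h2]), hmon _ h1 h2]
  have hformj := hform j (s.quiver.B_self j) hB
  have hformk := hform k hBkj (s.quiver.B_self k)
  have hexT : ∀ {l}, s.exchange l = laurentMonomial x'' (s.quiver.negRow l) *
      (1 + laurentMonomial x'' (s.quiver.B l)) → s.exchange l ∈ T := fun {l} hl => by
    rw [hl]
    exact mul_mem (laurentAlgebra.monomial_mem _ _)
      (add_mem (one_mem _) (laurentAlgebra.monomial_mem _ _))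
  have hcop : T.CoprimeIn (s.exchange j) (s.exchange k) := by
    rw [hformj, hformk]
    refine Subalgebra.CoprimeIn.unit_mul_unit_mul
      (laurentMonomial.ne_zero hs''n.cluster_ne_zero _) ?_
      (laurentMonomial.ne_zero hs''n.cluster_ne_zero _) ?_
      (h.coprimeIn_one_add hj hk hjk hs''n.1)
    · rw [← laurentMonomial.neg]; exact laurentAlgebra.monomial_mem _ _
    · rw [← laurentMonomial.neg]; exact laurentAlgebra.monomial_mem _ _
  have hvar : ∀ l, s.exchange l ∈ T → x'' l = s.exchange l / x l → x l ∈ T := by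
    intro l h1 h2
    have : x l = s.exchange l * (x'' l)⁻¹ := by
      rw [h2, inv_div, mul_div_cancel₀ _ (h.exchange_ne_zero l)]
    rw [this]
    exact mul_mem h1 (laurentAlgebra.inv_mem _ _)
  -- Once the exchange numerator at `l` is inverted, `x l` is a unit, so `T` absorbs the cluster
  -- that differs from `x''` only at `l`. The numerators at `j` and `k` are coprime, and the two
  -- localizations glue.
  have key : ∀ l (z : N → RatFunField N) (hl : s.exchange l ∈ T), x'' l = s.exchange l / x l →
      z l = x l → (∀ i, i ≠ l → z i = x'' i) → laurentAlgebra z ≤ T.away (s.exchange l) hl := by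
    intro l z hl h1 h2 h3
    refine laurentAlgebra.le_of_mem (fun i => Subalgebra.le_away ?_) fun i => ?_
    · by_cases hi : i = l
      · rw [hi, h2]; exact hvar l hl h1
      · rw [h3 i hi]; exact laurentAlgebra.var_mem _ _
    · by_cases hi : i = l
      · refine Subalgebra.mem_away_of_mul_mem ?_
        rw [hi, h2, ← div_eq_mul_inv, ← h1]
        exact laurentAlgebra.var_mem _ _
      · rw [h3 i hi]; exact Subalgebra.le_away (laurentAlgebra.inv_mem _ _)
  refine hcop.mem_of_mem_away (hp := hexT hformj) (hq := hexT hformk)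
    (key j x' _ hx''j (hx'i j hjk) (fun i hi => (hx''i i hi).symm) hfk)
    (key k (s.mutate j).cluster _ hx''k (mutate_cluster_of_ne s hjk.symm) (fun i hi => ?_) hfj)
  by_cases hij : i = j
  · rw [hij, hx''j, mutate_cluster_self]
  · rw [mutate_cluster_of_ne s hij, hx''i i hij, hx'i i hi]

theorem IsNondegenerate.mem_laurentAlgebra_mutate_mutate (h : s.IsNondegenerate)
    (hj : j ∉ s.quiver.frozen) (hk : k ∉ s.quiver.frozen) (hjk : j ≠ k)
    {f : RatFunField N} (hf : f ∈ laurentAlgebra s.cluster)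
    (hfj : f ∈ laurentAlgebra (s.mutate j).cluster)
    (hfk : f ∈ laurentAlgebra (s.mutate k).cluster) :
    f ∈ laurentAlgebra ((s.mutate k).mutate j).cluster := by
  rcases lt_trichotomy 0 (s.quiver.B j k) with hB | hB | hB
  · exact h.mem_laurentAlgebra_of_pos hj hk hB hf hfj hfk
  · exact h.mem_laurentAlgebra_of_eq_zero hj hk hjk hB.symm hfj hfk
  -- Reversing all arrows changes the sign of `B j k` but not the exchange numerators.
  · have := h.reverse.mem_laurentAlgebra_of_pos (j := j) (k := k) hj hk
      (by change 0 < -s.quiver.B j k; omega) hf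
      (by rw [mutate_reverse]; exact hfj) (by rw [mutate_reverse]; exact hfk)
    rwa [mutate_reverse, mutate_reverse] at this

end TwoMutations

/-- The upper cluster algebra of a seed: the elements which are Laurent polynomials in its cluster
and in all adjacent clusters. -/
noncomputable def upperAlgebra (s : ClusterSeed N) : Subalgebra ℚ (RatFunField N) :=
  laurentAlgebra s.cluster ⊓ ⨅ k, ⨅ _ : k ∉ s.quiver.frozen, laurentAlgebra (s.mutate k).cluster

theorem mem_upperAlgebra {f : RatFunField N} : f ∈ s.upperAlgebra ↔
    f ∈ laurentAlgebra s.cluster ∧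
      ∀ k ∉ s.quiver.frozen, f ∈ laurentAlgebra (s.mutate k).cluster := by
  simp [upperAlgebra, Algebra.mem_inf, Algebra.mem_iInf]

/-- The neighbour of the mutated seed in direction `k` is `s` itself; every other neighbour is two
mutations away from `s`. -/
theorem IsNondegenerate.upperAlgebra_le_mutate (h : s.IsNondegenerate) {k : N}
    (hk : k ∉ s.quiver.frozen) : s.upperAlgebra ≤ (s.mutate k).upperAlgebra := by
  intro f hf
  rw [mem_upperAlgebra] at hf ⊢
  refine ⟨hf.2 k hk, fun j hj => ?_⟩
  by_cases hjk : j = k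
  · rw [hjk, h.mutate_mutate]
    exact hf.1
  · exact h.mem_laurentAlgebra_mutate_mutate hj hk hjk hf.1 (hf.2 j hj) (hf.2 k hk)

theorem MutationEquiv.upperAlgebra_le {t : ClusterSeed N} (h : s.MutationEquiv t)
    (hs : s.IsNondegenerate) : s.upperAlgebra ≤ t.upperAlgebra := by
  induction h with
  | refl => exact le_rfl
  | tail hab hbc ih =>
    obtain ⟨k, hk, rfl⟩ := hbc
    exact ih.trans ((isNondegenerate hab hs).upperAlgebra_le_mutate hk)

theorem IsNondegenerate.cluster_mem_upperAlgebra (h : s.IsNondegenerate) (i : N) :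
    s.cluster i ∈ s.upperAlgebra := by
  rw [mem_upperAlgebra]
  refine ⟨laurentAlgebra.var_mem _ i, fun k hk => ?_⟩
  by_cases hik : i = k
  · subst hik
    have : s.cluster i = (s.mutate i).exchange i * ((s.mutate i).cluster i)⁻¹ := by
      rw [exchange_mutate_self, mutate_cluster_self, inv_div,
        mul_div_cancel₀ _ (h.exchange_ne_zero i)]
    rw [this]
    exact mul_mem (add_mem (laurentAlgebra.monomial_mem _ _) (laurentAlgebra.monomial_mem _ _))
      (laurentAlgebra.inv_mem _ _)
  · rw [← mutate_cluster_of_ne s hik]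
    exact laurentAlgebra.var_mem _ i

/-- The Laurent phenomenon. -/
theorem MutationEquiv.cluster_mem_upperAlgebra {t : ClusterSeed N} (h : s.MutationEquiv t)
    (hs : s.IsNondegenerate) (i : N) : t.cluster i ∈ s.upperAlgebra :=
  -- A cluster variable lies in the upper algebra of its own seed, which is carried back to `s` by
  -- invariance.
  (h.symm hs).upperAlgebra_le (h.isNondegenerate hs)
    ((h.isNondegenerate hs).cluster_mem_upperAlgebra i)

theorem inv_cluster_mem_upperAlgebra (s : ClusterSeed N) {i : N} (hi : i ∈ s.quiver.frozen) :
    (s.cluster i)⁻¹ ∈ s.upperAlgebra := by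
  rw [mem_upperAlgebra]
  refine ⟨laurentAlgebra.inv_mem _ i, fun k hk => ?_⟩
  rw [← mutate_cluster_of_ne s (k := k) (by rintro rfl; exact hk hi)]
  exact laurentAlgebra.inv_mem _ i

end ClusterSeed

/-! ### Kummer extensions of regular rings -/

/-- Adjoining roots of units to an integrally closed regular `ℚ`-algebra gives a regular ring. -/
theorem isRegularRing_of_adjoin_roots {R S : Type*} [CommRing R] [CommRing S] [Algebra R S]
    [Algebra ℚ S] [IsDomain S] [FaithfulSMul R S] [IsIntegrallyClosed R] [IsRegularRing R]
    (G : Set S) (hfin : G.Finite) (hG : Algebra.adjoin R G = ⊤)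
    (hroot : ∀ g ∈ G, ∃ d : ℕ, 0 < d ∧ ∃ u : Rˣ, g ^ d = algebraMap R S u) :
    IsRegularRing S := by
  have hint : Algebra.IsIntegral R S := by
    refine ⟨fun x => ?_⟩
    have hle : Algebra.adjoin R G ≤ integralClosure R S := Algebra.adjoin_le fun g hg => by
      obtain ⟨d, hd, u, hu⟩ := hroot g hg
      refine IsIntegral.of_pow hd ?_
      rw [hu]
      exact isIntegral_algebraMap
    exact hle (hG ▸ Algebra.mem_top)
  have hft : Algebra.FiniteType R S := ⟨⟨hfin.toFinset, by simpa using hG⟩⟩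
  -- Differentiating g^d = u gives d g^(d-1) dg = 0. The coefficient is a unit because g is a unit
  -- and d is invertible in a ℚ-algebra, so all differentials vanish.
  have hD : ∀ x : S, KaehlerDifferential.D R S x = 0 := fun x => by
    have hgen : Set.EqOn (KaehlerDifferential.D R S) (0 : Derivation R S (Ω[S⁄R])) G := by
      intro g hg
      obtain ⟨d, hd, u, hu⟩ := hroot g hg
      have h1 := (KaehlerDifferential.D R S).leibniz_pow g d
      rw [hu, Derivation.map_algebraMap, ← Nat.cast_smul_eq_nsmul S, smul_smul] at h1
      have hunit : IsUnit ((d : S) * g ^ (d - 1)) := by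
        refine IsUnit.mul ?_ (IsUnit.pow _ ?_)
        · have : (d : S) = algebraMap ℚ S d := by simp
          rw [this]
          exact (IsUnit.mk0 (d : ℚ) (by positivity)).map _
        · exact (isUnit_pow_iff hd.ne').mp (hu ▸ u.isUnit.map (algebraMap R S))
      have := hunit.smul_eq_zero.mp h1.symm
      simpa using this
    have := Derivation.eqOn_adjoin hgen
    exact this (hG ▸ Algebra.mem_top)
  have hunr : Algebra.FormallyUnramified R S := by
    refine ⟨?_⟩
    rw [← Submodule.subsingleton_iff S, ← subsingleton_iff_bot_eq_top, eq_comm,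
      ← KaehlerDifferential.span_range_derivation, Submodule.span_eq_bot]
    rintro _ ⟨x, rfl⟩
    exact hD x
  exact isRegularRing_of_unramified (R := R)

theorem AlgebraicIndependent.isRegularRing_adjoin {k K ι : Type*} [Field k] [Field K] [Algebra k K]
    [Finite ι] {y : ι → K} (hy : AlgebraicIndependent k y) :
    IsRegularRing (Algebra.adjoin k (Set.range y)) ∧
      IsIntegrallyClosed (Algebra.adjoin k (Set.range y)) :=
  ⟨IsRegularRing.of_ringEquiv hy.aevalEquiv.toRingEquiv,
    IsIntegrallyClosed.of_equiv hy.aevalEquiv.toRingEquiv⟩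

/-- Adjoining roots of units to a localization of a polynomial algebra gives a regular ring. -/
theorem Subalgebra.isRegularRing_of_roots {K ι : Type*} [Field K] [Algebra ℚ K] [Finite ι]
    {y : ι → K} (hy : AlgebraicIndependent ℚ y) {p : K} (hp0 : p ≠ 0)
    (hp : p ∈ Algebra.adjoin ℚ (Set.range y)) {G : Set K} (hfin : G.Finite)
    (hroot : ∀ g ∈ G, g ≠ 0 ∧ ∃ d : ℕ, 0 < d ∧ g ^ d ∈ (Algebra.adjoin ℚ (Set.range y)).away p hp ∧
      (g ^ d)⁻¹ ∈ (Algebra.adjoin ℚ (Set.range y)).away p hp) {L : Subalgebra ℚ K}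
    (hAL : (Algebra.adjoin ℚ (Set.range y)).away p hp ≤ L) (hGL : G ⊆ L)
    (hL : ∀ L' : Subalgebra ℚ K, (Algebra.adjoin ℚ (Set.range y)).away p hp ≤ L' → G ⊆ L' →
      L ≤ L') : IsRegularRing L := by
  obtain ⟨h1, h2⟩ := hy.isRegularRing_adjoin
  set A := (Algebra.adjoin ℚ (Set.range y)).away p hp with hA
  have hpA : p⁻¹ ∈ A := Subalgebra.mem_away_of_mul_mem (by
    rw [mul_inv_cancel₀ hp0]; exact one_mem _)
  have hregA : IsRegularRing A :=
    isRegularRing_of_le Subalgebra.le_away hp hp0 hpA fun b hb => hb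
  have hicA : IsIntegrallyClosed A :=
    isIntegrallyClosed_of_le Subalgebra.le_away hp hp0 hpA fun b hb => hb
  let _ : Algebra A L := (Subalgebra.inclusion hAL).toAlgebra
  have hmap : ∀ a : A, ((algebraMap A L a : L) : K) = a := fun _ => rfl
  have : FaithfulSMul A L := (faithfulSMul_iff_algebraMap_injective A L).mpr
    (Subalgebra.inclusion_injective hAL)
  let G' : Set L := Subtype.val ⁻¹' G
  refine isRegularRing_of_adjoin_roots (R := A) G' (hfin.preimage Subtype.val_injective.injOn) ?_ ?_
  -- The `A`-algebra generated by `G'`, viewed as a ℚ-subalgebra of `K` so that the minimality `hL`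
  -- applies to it.
  · let L' : Subalgebra ℚ K :=
      { carrier := {f | ∃ z ∈ Algebra.adjoin A G', (z : K) = f}
        mul_mem' := by
          rintro _ _ ⟨a, ha, rfl⟩ ⟨b, hb, rfl⟩
          exact ⟨a * b, mul_mem ha hb, rfl⟩
        add_mem' := by
          rintro _ _ ⟨a, ha, rfl⟩ ⟨b, hb, rfl⟩
          exact ⟨a + b, add_mem ha hb, rfl⟩
        algebraMap_mem' := fun r =>
          ⟨algebraMap A L (algebraMap ℚ A r), Subalgebra.algebraMap_mem _ _, rfl⟩ }
    have hLL' : L ≤ L' := hL L' (fun a ha => ⟨algebraMap A L ⟨a, ha⟩,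
      Subalgebra.algebraMap_mem _ _, rfl⟩) fun g hg => ⟨⟨g, hGL hg⟩, Algebra.subset_adjoin hg, rfl⟩
    refine eq_top_iff.mpr fun z _ => ?_
    obtain ⟨z', hz', hzz⟩ := hLL' z.2
    rwa [← Subtype.ext hzz]
  · intro g hg
    obtain ⟨hg0, d, hd, hgd, hgd'⟩ := hroot g hg
    refine ⟨d, hd, ⟨⟨_, hgd⟩, ⟨_, hgd'⟩, Subtype.ext ?_, Subtype.ext ?_⟩, Subtype.ext ?_⟩
    · exact mul_inv_cancel₀ (pow_ne_zero d hg0)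
    · exact inv_mul_cancel₀ (pow_ne_zero d hg0)
    · rfl

/-! ### Isolated seeds -/

theorem laurentMonomial.zsmul {N K : Type*} [Fintype N] [Field K] {x : N → K} (n : ℤ) (v : N → ℤ) :
    laurentMonomial x (n • v) = laurentMonomial x v ^ n := by
  rw [laurentMonomial, laurentMonomial, ← Finset.prod_zpow]
  refine Finset.prod_congr rfl fun i _ => ?_
  rw [← zpow_mul, Pi.smul_apply, smul_eq_mul, mul_comm]

theorem laurentMonomial.sum {N K ι : Type*} [Fintype N] [Field K] {x : N → K} (hx : ∀ i, x i ≠ 0)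
    (t : Finset ι) (v : ι → N → ℤ) :
    laurentMonomial x (∑ e ∈ t, v e) = ∏ e ∈ t, laurentMonomial x (v e) := by
  induction t using Finset.cons_induction with
  | empty => simp
  | cons a s ha ih => rw [Finset.sum_cons, Finset.prod_cons, laurentMonomial.add hx, ih]

namespace ClusterSeed

variable {N : Type u} [Fintype N] [DecidableEq N] {s : ClusterSeed N}

/-- The lower cluster algebra of a seed: generated by its cluster, the variables obtained from it
by one mutation, and the inverses of the frozen variables. -/
noncomputable def lowerAlgebra (s : ClusterSeed N) : Subalgebra ℚ (RatFunField N) :=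
  Algebra.adjoin ℚ
    ((Set.range s.cluster ∪ {f | ∃ k ∉ s.quiver.frozen, (s.mutate k).cluster k = f}) ∪
      {f | ∃ i ∈ s.quiver.frozen, (s.cluster i)⁻¹ = f})

theorem cluster_mem_lowerAlgebra (s : ClusterSeed N) (i : N) : s.cluster i ∈ s.lowerAlgebra :=
  Algebra.subset_adjoin (Or.inl (Or.inl ⟨i, rfl⟩))

theorem mutate_mem_lowerAlgebra (s : ClusterSeed N) {k : N} (hk : k ∉ s.quiver.frozen) :
    (s.mutate k).cluster k ∈ s.lowerAlgebra :=
  Algebra.subset_adjoin (Or.inl (Or.inr ⟨k, hk, rfl⟩))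

theorem inv_cluster_mem_lowerAlgebra (s : ClusterSeed N) {i : N} (hi : i ∈ s.quiver.frozen) :
    (s.cluster i)⁻¹ ∈ s.lowerAlgebra :=
  Algebra.subset_adjoin (Or.inr ⟨i, hi, rfl⟩)

theorem lowerAlgebra_le {L : Subalgebra ℚ (RatFunField N)} (h1 : ∀ i, s.cluster i ∈ L)
    (h2 : ∀ k ∉ s.quiver.frozen, (s.mutate k).cluster k ∈ L)
    (h3 : ∀ i ∈ s.quiver.frozen, (s.cluster i)⁻¹ ∈ L) : s.lowerAlgebra ≤ L := by
  refine Algebra.adjoin_le ?_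
  rintro _ ((⟨i, rfl⟩ | ⟨k, hk, rfl⟩) | ⟨i, hi, rfl⟩)
  exacts [h1 i, h2 k hk, h3 i hi]

theorem laurentMonomial_mem_lowerAlgebra {v : N → ℤ} (hv : ∀ i, v i < 0 → i ∈ s.quiver.frozen) :
    laurentMonomial s.cluster v ∈ s.lowerAlgebra :=
  laurentMonomial_mem (fun i _ => s.cluster_mem_lowerAlgebra i)
    fun i hi => s.inv_cluster_mem_lowerAlgebra (hv i hi)

/-- There are no arrows between mutable vertices. -/
def IsIsolated (s : ClusterSeed N) : Prop :=
  ∀ i ∉ s.quiver.frozen, ∀ j ∉ s.quiver.frozen, s.quiver.B i j = 0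

namespace IsNondegenerate

theorem upperAlgebra_le_of_isIsolated (h : s.IsNondegenerate) (hs : s.IsIsolated) :
    s.upperAlgebra ≤ s.lowerAlgebra := by
  intro f hf
  rw [mem_upperAlgebra] at hf
  refine h.mem_of_forall_mem_laurentAlgebra (Finset.univ.filter (· ∉ s.quiver.frozen))
    (fun k hk => (Finset.mem_filter.mp hk).2)
    (fun k hk l hl => hs k (Finset.mem_filter.mp hk).2 l (Finset.mem_filter.mp hl).2) hf.1
    (fun k hk => hf.2 k (Finset.mem_filter.mp hk).2) s.cluster_mem_lowerAlgebra
    (fun i hi => s.inv_cluster_mem_lowerAlgebra (by simpa using hi))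
    (fun k hk => s.mutate_mem_lowerAlgebra (Finset.mem_filter.mp hk).2)

end IsNondegenerate

/-- The rows of the matrix of `s` together with the coordinate vectors. -/
def rowsAndUnits (s : ClusterSeed N) : N ⊕ N → N → ℤ :=
  Sum.elim (fun k => s.quiver.B k) fun j => Pi.single j 1

/-- The elements attached to the rows and coordinate vectors. -/
noncomputable def rowsAndUnitsVar (s : ClusterSeed N) : N ⊕ N → RatFunField N :=
  Sum.elim (fun k => (s.mutate k).cluster k * laurentMonomial s.cluster (-s.quiver.negRow k))
    s.cluster

/-- The exchange relation in this form makes the monomial of row `k` a polynomial in the new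
coordinates: their product minus 1. -/
theorem IsNondegenerate.mul_rowsAndUnitsVar (h : s.IsNondegenerate) (k : N) :
    s.cluster k * s.rowsAndUnitsVar (.inl k) = 1 + laurentMonomial s.cluster (s.quiver.B k) := by
  have h1 := h.cluster_ne_zero k
  have h2 := laurentMonomial.ne_zero h.cluster_ne_zero (s.quiver.negRow k)
  rw [rowsAndUnitsVar, Sum.elim_inl, mutate_cluster_self, laurentMonomial.neg,
    exchange_eq_mul h.cluster_ne_zero]
  field_simp

/-- In an isolated seed the rows and the mutable coordinate vectors extend to a basis by frozen
coordinate vectors; every frozen coordinate vector has a multiple in the span of the rows and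
the chosen frozen coordinate vectors. -/
theorem IsNondegenerate.exists_basis (h : s.IsNondegenerate) (hs : s.IsIsolated) :
    ∃ b : Finset (N ⊕ N), b.card = Fintype.card N ∧
      (∀ k, .inl k ∈ b ↔ k ∉ s.quiver.frozen) ∧ (∀ k ∉ s.quiver.frozen, .inr k ∈ b) ∧
      ∀ f ∈ s.quiver.frozen, ∃ d : ℤ, d ≠ 0 ∧ ∃ l : N ⊕ N → ℤ,
        (∀ e, l e ≠ 0 → e ∈ b ∧ ∀ j, e = .inr j → j ∈ s.quiver.frozen) ∧
        d • Pi.single f 1 = ∑ e, l e • s.rowsAndUnits e := by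
  classical
  let v : N ⊕ N → N → ℚ := fun e i => s.rowsAndUnits e i
  -- The vectors in `s0` (mutable rows, mutable unit vectors) must all be kept; `t` adds the frozen
  -- unit vectors allowed in the extension to a basis.
  let s0 : Set (N ⊕ N) := {e | Sum.elim (· ∉ s.quiver.frozen) (· ∉ s.quiver.frozen) e}
  let t : Set (N ⊕ N) := {e | Sum.elim (· ∉ s.quiver.frozen) (fun _ => True) e}
  have hlc : ∀ (l : N ⊕ N → ℚ) i, (∑ e, l e • v e) i =
      ∑ k, l (.inl k) * s.quiver.B k i + l (.inr i) := by
    intro l i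
    rw [Fintype.sum_sum_type, Pi.add_apply, Finset.sum_apply, Finset.sum_apply]
    simp [v, rowsAndUnits, Pi.single_apply]
  -- Mutable rows of an isolated seed vanish in mutable columns, so a mutable coordinate of a
  -- combination is just the coefficient of its unit vector.
  have hmut : ∀ (l : N ⊕ N → ℚ), (∀ e, l e ≠ 0 → e ∈ t) → ∀ i ∉ s.quiver.frozen,
      (∑ e, l e • v e) i = l (.inr i) := by
    intro l hl i hi
    rw [hlc, Finset.sum_eq_zero, zero_add]
    intro k _
    by_cases hk : k ∈ s.quiver.frozen
    · have : l (.inl k) = 0 := by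
        by_contra h0
        exact hl _ h0 hk
      rw [this, zero_mul]
    · rw [hs k hk i hi, Int.cast_zero, mul_zero]
  have hs0t : s0 ⊆ t := by
    rintro (k | k) hk
    · exact hk
    · exact trivial
  have hli : LinearIndepOn ℚ v s0 := by
    rw [linearIndepOn_iff]
    intro l hl hl0
    have hsupp : ∀ e, l e ≠ 0 → e ∈ s0 := fun e he => hl (Finsupp.mem_support_iff.mpr he)
    rw [Finsupp.linearCombination_apply, Finsupp.sum_fintype _ _ (by simp)] at hl0
    have hr : ∀ i, l (.inr i) = 0 := by
      intro i
      by_cases hi : i ∈ s.quiver.frozen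
      · by_contra h0
        exact hsupp _ h0 hi
      · rw [← hmut l (fun e he => hs0t (hsupp e he)) i hi, hl0, Pi.zero_apply]
    have hk : (fun k => l (.inl k)) = 0 := h.hasIndependentRows _
      (fun k hk => by
        by_contra h0
        exact hsupp _ h0 hk)
      fun i => by
        have := hlc l i
        rw [hl0, hr i] at this
        simpa using this.symm
    ext (k | i)
    · exact congrFun hk k
    · exact hr i
  obtain ⟨b, hbt, hsb, hspan, hb⟩ := exists_linearIndepOn_extension hli hs0t
  have htop : Submodule.span ℚ (v '' b) = ⊤ := by
    refine eq_top_iff.mpr ((Pi.basisFun ℚ N).span_eq.ge.trans (Submodule.span_le.mpr ?_))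
    rintro _ ⟨i, rfl⟩
    refine hspan ⟨.inr i, trivial, ?_⟩
    funext j
    simp [v, rowsAndUnits, Pi.single_apply]
  refine ⟨b.toFinset, ?_, ?_, ?_, ?_⟩
  · have hbasis := Module.Basis.mk hb (by rw [← Set.image_eq_range, htop])
    rw [Set.toFinset_card, ← Module.finrank_eq_card_basis hbasis,
      Module.finrank_fintype_fun_eq_card]
  · intro k
    rw [Set.mem_toFinset]
    exact ⟨fun hk => hbt hk, fun hk => hsb hk⟩
  · intro k hk
    rw [Set.mem_toFinset]
    exact hsb hk
  · intro f hf
    have hmem : (Pi.single f 1 : N → ℚ) ∈ Submodule.span ℚ (v '' b) := htop ▸ Submodule.mem_top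
    rw [Finsupp.mem_span_image_iff_linearCombination] at hmem
    obtain ⟨l, hlb, hl⟩ := hmem
    rw [Finsupp.linearCombination_apply, Finsupp.sum_fintype _ _ (by simp)] at hl
    have hsupp : ∀ e, l e ≠ 0 → e ∈ b := fun e he => hlb (Finsupp.mem_support_iff.mpr he)
    obtain ⟨d, hd⟩ := IsLocalization.exist_integer_multiples_of_finite (nonZeroDivisors ℤ)
      (fun e => l e)
    choose l' hl' using hd
    have hl'' : ∀ e, (l' e : ℚ) = (d : ℤ) * l e := fun e => by
      simpa using hl' e
    refine ⟨d, nonZeroDivisors.ne_zero d.2, l', fun e he => ?_, ?_⟩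
    · have hle : l e ≠ 0 := by
        intro h0
        have := hl'' e
        rw [h0, mul_zero] at this
        exact he (by exact_mod_cast this)
      refine ⟨Set.mem_toFinset.mpr (hsupp e hle), ?_⟩
      rintro i rfl
      by_contra hi
      refine hle ?_
      rw [← hmut l (fun e he => hbt (hsupp e he)) i hi, hl, Pi.single_eq_of_ne]
      rintro rfl
      exact hi hf
    · funext i
      have h1 := congrFun hl i
      rw [Finset.sum_apply] at h1 ⊢
      have h2 : (((d : ℤ) • Pi.single f 1 : N → ℤ) i : ℚ) =
          ((∑ e, (l' e • s.rowsAndUnits e) i : ℤ) : ℚ) := by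
        have h3 : ((∑ e, (l' e • s.rowsAndUnits e) i : ℤ) : ℚ) = (d : ℤ) * ∑ e, (l e • v e) i := by
          push_cast
          rw [Finset.mul_sum]
          refine Finset.sum_congr rfl fun e _ => ?_
          simp only [Pi.smul_apply, smul_eq_mul, v]
          push_cast
          rw [hl'', mul_assoc]
        rw [h3, h1]
        simp [Pi.single_apply]
      exact_mod_cast h2

/-- The elements `Y e`, `e ∈ b`, are polynomial coordinates. After inverting the monomials of the
mutable rows and of the chosen frozen unit vectors, some power of each frozen variable is a unit, so
adjoining the frozen variables and their inverses is a Kummer extension. The result is the lower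
algebra. -/
theorem IsNondegenerate.isRegularRing_of_isIsolated (h : s.IsNondegenerate) (hs : s.IsIsolated) :
    IsRegularRing s.lowerAlgebra := by
  classical
  obtain ⟨b, hcard, hbl, hbr, hfroz⟩ := h.exists_basis hs
  set x := s.cluster with hx
  have hx0 := h.cluster_ne_zero
  set Y := s.rowsAndUnitsVar with hY
  let y : b → RatFunField N := fun e => Y e
  set A := Algebra.adjoin ℚ (Set.range y) with hA
  have hYA : ∀ e ∈ b, Y e ∈ A := fun e he => Algebra.subset_adjoin ⟨⟨e, he⟩, rfl⟩
  let m : N ⊕ N → RatFunField N := fun e => laurentMonomial x (s.rowsAndUnits e)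
  have hm0 : ∀ e, m e ≠ 0 := fun e => laurentMonomial.ne_zero hx0 _
  -- Mutable unit vectors are left out: their monomials are the mutable variables, which must not be
  -- inverted.
  let t := b.filter fun e => ∀ j, e = .inr j → j ∈ s.quiver.frozen
  have hmA : ∀ e ∈ t, m e ∈ A := by
    rintro (k | j) he <;> have heb := (Finset.mem_filter.mp he).1
    · have h1 : m (.inl k) = x k * Y (.inl k) - 1 := by
        rw [hx, hY, h.mul_rowsAndUnitsVar, add_sub_cancel_left]
        rfl
      rw [h1]
      exact sub_mem (mul_mem (hYA (.inr k) (hbr k ((hbl k).mp heb))) (hYA _ heb)) (one_mem _)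
    · have h1 : m (.inr j) = Y (.inr j) := by
        change laurentMonomial x (Pi.single j 1) = x j
        rw [laurentMonomial.single, zpow_one]
      rw [h1]
      exact hYA _ heb
  set p := ∏ e ∈ t, m e with hp
  have hp0 : p ≠ 0 := Finset.prod_ne_zero_iff.mpr fun e _ => hm0 e
  have hpA : p ∈ A := prod_mem hmA
  have hminv : ∀ e ∈ t, (m e)⁻¹ ∈ A.away p hpA := fun e he => by
    refine Subalgebra.mem_away_of_mul_mem ?_
    rw [hp, ← Finset.mul_prod_erase _ _ he, mul_right_comm, mul_inv_cancel₀ (hm0 e), one_mul]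
    exact prod_mem fun e' he' => hmA e' (Finset.mem_of_mem_erase he')
  have hpow : ∀ f ∈ s.quiver.frozen, ∃ d : ℕ, 0 < d ∧ x f ^ d ∈ A.away p hpA ∧
      (x f ^ d)⁻¹ ∈ A.away p hpA := by
    intro f hf
    obtain ⟨d, hd, l, hl, hdl⟩ := hfroz f hf
    -- The cases ε = ± sign(d) give the |d|-th power and its inverse.
    have hxd : ∀ ε : ℤ, x f ^ (ε * d) ∈ A.away p hpA := by
      intro ε
      have h1 : x f ^ (ε * d) = ∏ e, m e ^ (ε * l e) := by
        have h2 : laurentMonomial x (ε • d • Pi.single f 1) = x f ^ (ε * d) := by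
          rw [laurentMonomial.zsmul, laurentMonomial.zsmul, laurentMonomial.single, zpow_one,
            ← zpow_mul, mul_comm]
        rw [← h2, hdl, Finset.smul_sum, laurentMonomial.sum hx0]
        refine Finset.prod_congr rfl fun e _ => ?_
        rw [laurentMonomial.zsmul, laurentMonomial.zsmul, ← zpow_mul, mul_comm]
      rw [h1]
      refine prod_mem fun e _ => ?_
      by_cases he : l e = 0
      · rw [he, mul_zero, zpow_zero]; exact one_mem _
      · have het : e ∈ t := Finset.mem_filter.mpr (hl e he)
        exact zpow_mem_of_inv_mem (Subalgebra.le_away (hmA e het)) (hminv e het) _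
    refine ⟨d.natAbs, Int.natAbs_pos.mpr hd, ?_, ?_⟩
    · have := hxd d.sign
      rwa [Int.sign_mul_self_eq_natAbs, zpow_natCast] at this
    · have := hxd (-d.sign)
      rwa [neg_mul, Int.sign_mul_self_eq_natAbs, zpow_neg, zpow_natCast] at this
  -- There are |N| coordinates, and every cluster variable is algebraic over them, the frozen ones
  -- through their powers.
  have hyind : AlgebraicIndependent ℚ y := by
    refine algebraicIndependent_of_isAlgebraic h.1 (by rw [Fintype.card_coe, hcard]) fun i => ?_
    set E := IntermediateField.adjoin ℚ (Set.range y)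
    have hAE : ∀ f ∈ A, f ∈ E := fun f hf => IntermediateField.algebra_adjoin_le_adjoin _ _ hf
    by_cases hi : i ∈ s.quiver.frozen
    · obtain ⟨d, hd, ⟨n, hn⟩, -⟩ := hpow i hi
      refine IsAlgebraic.of_pow hd ?_
      have : x i ^ d ∈ E := by
        have h1 : x i ^ d = p ^ n * x i ^ d / p ^ n := by
          rw [mul_div_cancel_left₀ _ (pow_ne_zero n hp0)]
        rw [h1]
        exact E.div_mem (hAE _ hn) (E.pow_mem (hAE _ hpA) n)
      exact isAlgebraic_algebraMap (⟨_, this⟩ : E)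
    · exact isAlgebraic_algebraMap (⟨_, hAE _ (hYA (.inr i) (hbr i hi))⟩ : E)
  have hrow : ∀ k ∉ s.quiver.frozen, ∀ i, s.quiver.B k i ≠ 0 → i ∈ s.quiver.frozen :=
    fun k hk i hi => by
      by_contra hi'
      exact hi (hs k hk i hi')
  have hneg : ∀ k ∉ s.quiver.frozen, ∀ i, s.quiver.negRow k i ≠ 0 → i ∈ s.quiver.frozen :=
    fun k hk i hi => hrow k hk i fun h0 => hi (by simp [IceQuiver.negRow, h0])
  have hAL : A ≤ s.lowerAlgebra := by
    refine Algebra.adjoin_le ?_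
    rintro _ ⟨⟨k | j, he⟩, rfl⟩
    · have hk := (hbl k).mp he
      exact mul_mem (s.mutate_mem_lowerAlgebra hk) (laurentMonomial_mem_lowerAlgebra fun i hi =>
        hneg k hk i fun h0 => by simp [h0] at hi)
    · exact s.cluster_mem_lowerAlgebra j
  have hmL : ∀ e ∈ t, (m e)⁻¹ ∈ s.lowerAlgebra := by
    rintro (k | j) he <;> obtain ⟨heb, hej⟩ := Finset.mem_filter.mp he <;>
      rw [← laurentMonomial.neg] <;> refine laurentMonomial_mem_lowerAlgebra fun i hi => ?_
    · exact hrow k ((hbl k).mp heb) i fun h0 => by simp [rowsAndUnits, h0] at hi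
    · by_cases hij : i = j
      · exact hij ▸ hej j rfl
      · simp [rowsAndUnits, hij] at hi
  refine Subalgebra.isRegularRing_of_roots hyind hp0 hpA
    (G := {g | ∃ f ∈ s.quiver.frozen, x f = g} ∪ {g | ∃ f ∈ s.quiver.frozen, (x f)⁻¹ = g})
    ?_ ?_ ?_ ?_ ?_
  · exact ((Set.finite_range x).subset (by rintro _ ⟨f, _, rfl⟩; exact ⟨f, rfl⟩)).union
      ((Set.finite_range fun f => (x f)⁻¹).subset (by rintro _ ⟨f, _, rfl⟩; exact ⟨f, rfl⟩))
  · rintro _ (⟨f, hf, rfl⟩ | ⟨f, hf, rfl⟩) <;> obtain ⟨d, hd, h1, h2⟩ := hpow f hf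
    · exact ⟨hx0 f, d, hd, h1, h2⟩
    · exact ⟨inv_ne_zero (hx0 f), d, hd, by rwa [inv_pow], by rwa [inv_pow, inv_inv]⟩
  · rintro f ⟨n, hn⟩
    have h1 : f = (∏ e ∈ t, (m e)⁻¹) ^ n * (p ^ n * f) := by
      rw [Finset.prod_inv_distrib, ← hp, ← mul_assoc, ← mul_pow, inv_mul_cancel₀ hp0, one_pow,
        one_mul]
    rw [h1]
    exact mul_mem (pow_mem (prod_mem hmL) n) (hAL hn)
  · rintro _ (⟨f, hf, rfl⟩ | ⟨f, hf, rfl⟩)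
    · exact s.cluster_mem_lowerAlgebra f
    · exact s.inv_cluster_mem_lowerAlgebra hf
  · intro L' h1 h2
    have hxL : ∀ i, x i ∈ L' := fun i => by
      by_cases hi : i ∈ s.quiver.frozen
      · exact h2 (Or.inl ⟨i, hi, rfl⟩)
      · exact h1 (Subalgebra.le_away (hYA (.inr i) (hbr i hi)))
    refine lowerAlgebra_le hxL (fun k hk => ?_) fun i hi => h2 (Or.inr ⟨i, hi, rfl⟩)
    have h3 : (s.mutate k).cluster k = Y (.inl k) * laurentMonomial x (s.quiver.negRow k) := by
      rw [hY, rowsAndUnitsVar, Sum.elim_inl, laurentMonomial.neg,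
        inv_mul_cancel_right₀ (laurentMonomial.ne_zero hx0 _)]
    rw [h3]
    refine mul_mem (h1 (Subalgebra.le_away (hYA _ ((hbl k).mpr hk))))
      (laurentMonomial_mem (fun i _ => hxL i) fun i hi => ?_)
    exact absurd hi (by simp [IceQuiver.negRow])

end ClusterSeed

/-! ### Covers of a subring of a field -/

section Cover

variable {K : Type*} [Field K] {A : Subring K}

/-- A maximal ideal containing `F` would be the contraction of a prime of some `B` in which an
element of `F` is invertible. -/
theorem Subring.span_eq_top_of_cover {F : Set A}
    (h : ∀ P : PrimeSpectrum A, ∃ a ∈ F, (a : K) ≠ 0 ∧ ∃ (B : Subring K) (hAB : A ≤ B),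
      (a : K)⁻¹ ∈ B ∧ P ∈ Set.range (PrimeSpectrum.comap (Subring.inclusion hAB))) :
    Ideal.span F = ⊤ := by
  by_contra hne
  obtain ⟨P, hP, hFP⟩ := Ideal.exists_le_maximal _ hne
  obtain ⟨a, ha, ha0, B, hAB, hinv, q, hq⟩ := h ⟨P, hP.isPrime⟩
  have haq : Subring.inclusion hAB a ∈ q.asIdeal := by
    have haP : a ∈ (PrimeSpectrum.comap (Subring.inclusion hAB) q).asIdeal := by
      rw [hq]
      exact hFP (Ideal.subset_span ha)
    exact haP
  refine q.isPrime.ne_top ((Ideal.eq_top_iff_one _).mpr ?_)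
  have hone : (⟨_, hinv⟩ : B) * Subring.inclusion hAB a = 1 := Subtype.ext (inv_mul_cancel₀ ha0)
  rw [← hone]
  exact q.asIdeal.mul_mem_left _ haq

/-- The cover is given over ℤ, but a unit ideal extends to a unit ideal of the ℚ-algebra, where
regularity is checked. -/
theorem Subring.isRegularRing_adjoin_of_cover [Algebra ℚ K] (F : Set A) (hF : Ideal.span F = ⊤)
    (h : ∀ a ∈ F, (a : K) ≠ 0 ∧ ∃ B : Subalgebra ℚ K, Algebra.adjoin ℚ (A : Set K) ≤ B ∧
      (a : K)⁻¹ ∈ B ∧ (∀ b ∈ B, ∃ n : ℕ, (a : K) ^ n * b ∈ Algebra.adjoin ℚ (A : Set K)) ∧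
      IsRegularRing B) : IsRegularRing (Algebra.adjoin ℚ (A : Set K)) := by
  let ι : A →+* Algebra.adjoin ℚ (A : Set K) :=
    Subring.inclusion (T := (Algebra.adjoin ℚ (A : Set K)).toSubring)
      fun _ hf => Algebra.subset_adjoin hf
  refine Subalgebra.isRegularRing_of_cover (ι '' F) ?_ ?_
  · rw [← Ideal.map_span, hF, Ideal.map_top]
  · rintro _ ⟨a, ha, rfl⟩
    exact h a ha

end Cover

/-! ### Acyclic seeds -/

namespace IceQuiver

variable {N : Type u} {Q : IceQuiver N}

theorem IsAcyclic.freeze [DecidableEq N] (h : Q.IsAcyclic) (S : Finset N) :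
    (Q.freeze S).IsAcyclic := by
  have hle : (Q.freeze S).MutableArrow ≤ Q.MutableArrow := fun a b hab =>
    ⟨fun ha => hab.1 (Finset.mem_union_left S ha), fun hb => hab.2.1 (Finset.mem_union_left S hb),
      hab.2.2⟩
  exact fun i hi => h i (Relation.TransGen.mono hle i i hi)

/-- In an acyclic quiver some mutable arrow ends in a mutable sink. -/
theorem IsAcyclic.exists_arrow_to_sink [Finite N] (h : Q.IsAcyclic) {i j : N}
    (hij : Q.MutableArrow i j) : ∃ i j, Q.MutableArrow i j ∧ ∀ l, ¬ Q.MutableArrow j l := by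
  have : IsTrans N fun a b => Relation.TransGen Q.MutableArrow b a :=
    ⟨fun _ _ _ hab hbc => hbc.trans hab⟩
  have : Std.Irrefl fun a b => Relation.TransGen Q.MutableArrow b a := ⟨h⟩
  have hwf := Finite.wellFounded_of_trans_of_irrefl
    fun a b => Relation.TransGen Q.MutableArrow b a
  obtain ⟨j', ⟨i', hij'⟩, hmin⟩ := hwf.has_min {j | ∃ i, Q.MutableArrow i j} ⟨j, i, hij⟩
  exact ⟨i', j', hij', fun l hl => hmin l ⟨j', hl⟩ (.single hl)⟩

end IceQuiver

namespace ClusterSeed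

variable {N : Type u} [Fintype N] [DecidableEq N] {s : ClusterSeed N}

theorem upperAlgebra_le_freeze (s : ClusterSeed N) (S : Finset N) :
    s.upperAlgebra ≤ (s.freeze S).upperAlgebra := by
  intro f hf
  rw [mem_upperAlgebra] at hf ⊢
  exact ⟨hf.1, fun k hk => hf.2 k fun hk' => hk (by simp [hk'])⟩

theorem lowerAlgebra_le_freeze (s : ClusterSeed N) (i : N) :
    s.lowerAlgebra ≤ (s.freeze {i}).lowerAlgebra := by
  refine lowerAlgebra_le (s.freeze {i}).cluster_mem_lowerAlgebra (fun k hk => ?_)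
    fun l hl => (s.freeze {i}).inv_cluster_mem_lowerAlgebra (by simp [hl])
  by_cases hki : k = i
  · subst hki
    rw [mutate_cluster_self, div_eq_mul_inv]
    have h0 : ∀ v : N → ℤ, 0 ≤ v → laurentMonomial s.cluster v ∈ (s.freeze {k}).lowerAlgebra :=
      fun v hv => laurentMonomial_mem_lowerAlgebra (s := s.freeze {k}) fun l hl =>
        absurd (hv l) (not_le.mpr hl)
    refine mul_mem (add_mem (h0 _ fun l => le_max_right _ _) (h0 _ fun l => le_max_right _ _)) ?_
    exact (s.freeze {k}).inv_cluster_mem_lowerAlgebra (by simp)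
  · exact (s.freeze {i}).mutate_mem_lowerAlgebra (by simp [hk, hki])

/-- Together with `lowerAlgebra_le_freeze` this identifies freezing with localization at the frozen
variable, for lower algebras. -/
theorem freeze_lowerAlgebra_le (s : ClusterSeed N) {i : N} (hi : s.cluster i ≠ 0) :
    (s.freeze {i}).lowerAlgebra ≤
      s.lowerAlgebra.away (s.cluster i) (s.cluster_mem_lowerAlgebra i) := by
  refine lowerAlgebra_le (fun l => Subalgebra.le_away (s.cluster_mem_lowerAlgebra l))
    (fun k hk => Subalgebra.le_away (s.mutate_mem_lowerAlgebra fun hk' => hk (by simp [hk'])))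
    fun l hl => ?_
  rcases Finset.mem_union.mp (show l ∈ s.quiver.frozen ∪ {i} from hl) with hl | hl
  · exact Subalgebra.le_away (s.inv_cluster_mem_lowerAlgebra hl)
  · rw [Finset.mem_singleton] at hl
    subst hl
    refine Subalgebra.mem_away_of_mul_mem ?_
    rw [freeze_cluster, mul_inv_cancel₀ hi]
    exact one_mem _

/-- The two ends of an arrow into a mutable sink generate the unit ideal. -/
theorem IsNondegenerate.exists_add_eq_one (h : s.IsNondegenerate) {i j : N}
    (hij : s.quiver.MutableArrow i j) (hj : ∀ l, ¬ s.quiver.MutableArrow j l) :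
    ∃ a ∈ s.lowerAlgebra, ∃ b ∈ s.lowerAlgebra, a * s.cluster i + b * s.cluster j = 1 := by
  have hsink : ∀ l, 0 < s.quiver.B j l → l ∈ s.quiver.frozen := fun l hl => by
    by_contra hl'
    exact hj l ⟨hij.2.1, hl', hl⟩
  have hBji : s.quiver.B j i = -s.quiver.B i j := s.quiver.skew j i
  have hBij := hij.2.2
  have h0 := h.cluster_ne_zero
  -- All arrows out of the sink `j` end in frozen vertices, so `M` is a unit, while the other
  -- exchange monomial contains the variable at `i`. Dividing the exchange relation by `M` gives the
  -- identity.
  set M := laurentMonomial s.cluster (s.quiver.posRow j)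
  have hM0 : M ≠ 0 := laurentMonomial.ne_zero h0 _
  have hMinv : M⁻¹ ∈ s.lowerAlgebra := by
    rw [← laurentMonomial.neg]
    refine laurentMonomial_mem_lowerAlgebra fun l hl => hsink l ?_
    simp only [IceQuiver.posRow, Pi.neg_apply] at hl
    omega
  have hneg : laurentMonomial s.cluster (s.quiver.negRow j) =
      s.cluster i * laurentMonomial s.cluster (s.quiver.negRow j - Pi.single i 1) := by
    conv_rhs => rw [← zpow_one (s.cluster i), ← laurentMonomial.single, ← laurentMonomial.add h0,
      add_sub_cancel]
  have hrest : laurentMonomial s.cluster (s.quiver.negRow j - Pi.single i 1) ∈ s.lowerAlgebra := by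
    refine laurentMonomial_mem_lowerAlgebra fun l hl => absurd hl ?_
    by_cases hli : l = i
    · subst hli
      simp only [IceQuiver.negRow, Pi.sub_apply, Pi.single_eq_same]
      omega
    · simp [IceQuiver.negRow, hli]
  refine ⟨-(M⁻¹ * laurentMonomial s.cluster (s.quiver.negRow j - Pi.single i 1)),
    neg_mem (mul_mem hMinv hrest), M⁻¹ * (s.mutate j).cluster j,
    mul_mem hMinv (s.mutate_mem_lowerAlgebra hij.2.1), ?_⟩
  have hex : (s.mutate j).cluster j * s.cluster j = M + s.cluster i *
      laurentMonomial s.cluster (s.quiver.negRow j - Pi.single i 1) := by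
    rw [mutate_cluster_self, div_mul_cancel₀ _ (h0 j), exchange, hneg]
  rw [mul_assoc, hex, mul_add, inv_mul_cancel₀ hM0]
  ring

/-- For an acyclic seed the upper and lower cluster algebras agree and are regular. -/
theorem IsNondegenerate.upperAlgebra_le_and_isRegularRing (h : s.IsNondegenerate)
    (hs : s.quiver.IsAcyclic) :
    s.upperAlgebra ≤ s.lowerAlgebra ∧ IsRegularRing s.lowerAlgebra := by
  -- Induction on the number of mutable vertices. Isolated seeds are the base; otherwise the two
  -- ends of an arrow into a sink are frozen separately, and both claims glue from the resulting
  -- comaximal localizations.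
  induction hn : (Finset.univ \ s.quiver.frozen).card using Nat.strong_induction_on
    generalizing s with
  | _ n ih =>
    subst hn
    by_cases hiso : s.IsIsolated
    · exact ⟨h.upperAlgebra_le_of_isIsolated hiso, h.isRegularRing_of_isIsolated hiso⟩
    obtain ⟨i, j, hij⟩ : ∃ i j, s.quiver.MutableArrow i j := by
      simp only [IsIsolated, not_forall] at hiso
      obtain ⟨i, hi, j, hj, hB⟩ := hiso
      rcases lt_or_gt_of_ne hB with hB | hB
      · exact ⟨j, i, hj, hi, by rw [s.quiver.skew]; omega⟩
      · exact ⟨i, j, hi, hj, hB⟩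
    obtain ⟨i, j, hij, hj⟩ := hs.exists_arrow_to_sink hij
    obtain ⟨a, ha, b, hb, hab⟩ := h.exists_add_eq_one hij hj
    have hfreeze : ∀ l ∉ s.quiver.frozen,
        (s.freeze {l}).upperAlgebra ≤ (s.freeze {l}).lowerAlgebra ∧
        IsRegularRing (s.freeze {l}).lowerAlgebra := fun l hl => by
      refine ih _ ?_ (h.freeze {l}) (hs.freeze {l}) rfl
      refine Finset.card_lt_card (Finset.ssubset_iff_of_subset ?_ |>.mpr ⟨l, by simp [hl], by simp⟩)
      exact Finset.sdiff_subset_sdiff subset_rfl Finset.subset_union_left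
    refine ⟨fun f hf => ?_, ?_⟩
    · refine (Subalgebra.CoprimeIn.of_add_eq_one ha hb hab).mem_of_mem_away
        (hp := s.cluster_mem_lowerAlgebra i) (hq := s.cluster_mem_lowerAlgebra j) ?_ ?_
      · exact s.freeze_lowerAlgebra_le (h.cluster_ne_zero i)
          ((hfreeze i hij.1).1 (s.upperAlgebra_le_freeze _ hf))
      · exact s.freeze_lowerAlgebra_le (h.cluster_ne_zero j)
          ((hfreeze j hij.2.1).1 (s.upperAlgebra_le_freeze _ hf))
    · refine Subalgebra.isRegularRing_of_cover
        {(⟨_, s.cluster_mem_lowerAlgebra i⟩ : s.lowerAlgebra),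
          ⟨_, s.cluster_mem_lowerAlgebra j⟩} ?_ ?_
      · rw [Ideal.eq_top_iff_one, Ideal.mem_span_pair]
        exact ⟨⟨a, ha⟩, ⟨b, hb⟩, Subtype.ext hab⟩
      · have key : ∀ l ∉ s.quiver.frozen, s.cluster l ≠ 0 ∧ ∃ B : Subalgebra ℚ (RatFunField N),
            s.lowerAlgebra ≤ B ∧ (s.cluster l)⁻¹ ∈ B ∧
            (∀ b ∈ B, ∃ n : ℕ, s.cluster l ^ n * b ∈ s.lowerAlgebra) ∧ IsRegularRing B :=
          fun l hl => ⟨h.cluster_ne_zero l, _, s.lowerAlgebra_le_freeze l,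
            (s.freeze {l}).inv_cluster_mem_lowerAlgebra (by simp),
            fun b hb => s.freeze_lowerAlgebra_le (h.cluster_ne_zero l) hb, (hfreeze l hl).2⟩
        rintro _ (rfl | rfl)
        · exact key i hij.1
        · exact key j hij.2.1

/-! ### Cluster algebras with rational coefficients -/

/-- The cluster algebra with rational coefficients. -/
noncomputable def rationalAlgebra (s : ClusterSeed N) : Subalgebra ℚ (RatFunField N) :=
  Algebra.adjoin ℚ s.clusterAlgebra

theorem clusterAlgebra_le {L : Subring (RatFunField N)}
    (h1 : ∀ t, s.MutationEquiv t → ∀ i, t.cluster i ∈ L)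
    (h2 : ∀ i ∈ s.quiver.frozen, (s.cluster i)⁻¹ ∈ L) : s.clusterAlgebra ≤ L := by
  refine Subring.closure_le.mpr ?_
  rintro _ (⟨t, ht, i, rfl⟩ | ⟨i, hi, rfl⟩)
  exacts [h1 t ht i, h2 i hi]

theorem MutationEquiv.cluster_mem {t : ClusterSeed N} (h : s.MutationEquiv t) (i : N) :
    t.cluster i ∈ s.clusterAlgebra :=
  Subring.subset_closure (Or.inl ⟨t, h, i, rfl⟩)

theorem inv_cluster_mem (s : ClusterSeed N) {i : N} (hi : i ∈ s.quiver.frozen) :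
    (s.cluster i)⁻¹ ∈ s.clusterAlgebra :=
  Subring.subset_closure (Or.inr ⟨i, hi, rfl⟩)

theorem mem_rationalAlgebra {f : RatFunField N} (h : f ∈ s.clusterAlgebra) :
    f ∈ s.rationalAlgebra := Algebra.subset_adjoin h

theorem rationalAlgebra_le {L : Subalgebra ℚ (RatFunField N)}
    (h1 : ∀ t, s.MutationEquiv t → ∀ i, t.cluster i ∈ L)
    (h2 : ∀ i ∈ s.quiver.frozen, (s.cluster i)⁻¹ ∈ L) : s.rationalAlgebra ≤ L :=
  Algebra.adjoin_le (clusterAlgebra_le (L := L.toSubring) h1 h2)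

/-- At an acyclic seed the inclusions lower ≤ cluster algebra ≤ upper ≤ lower close up; the middle
one is the Laurent phenomenon. -/
theorem IsNondegenerate.isRegularRing_rationalAlgebra (h : s.IsNondegenerate)
    (hs : s.HasAcyclicSeed) : IsRegularRing s.rationalAlgebra := by
  obtain ⟨t, hst, ht⟩ := hs
  obtain ⟨h1, h2⟩ := (hst.isNondegenerate h).upperAlgebra_le_and_isRegularRing ht
  have : s.rationalAlgebra = t.lowerAlgebra := by
    refine le_antisymm ((rationalAlgebra_le (fun r hr i => ?_) fun i hi => ?_).trans h1) ?_
    · exact MutationEquiv.cluster_mem_upperAlgebra ((hst.symm h).trans hr)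
        (hst.isNondegenerate h) i
    · rw [← hst.cluster_eq_of_mem_frozen hi]
      exact t.inv_cluster_mem_upperAlgebra (by rwa [hst.frozen_eq])
    · refine lowerAlgebra_le (fun i => mem_rationalAlgebra (hst.cluster_mem i))
        (fun k hk => mem_rationalAlgebra (MutationEquiv.cluster_mem (.tail hst ⟨k, hk, rfl⟩) k))
        fun i hi => ?_
      rw [hst.frozen_eq] at hi
      rw [hst.cluster_eq_of_mem_frozen hi]
      exact mem_rationalAlgebra (s.inv_cluster_mem hi)
  rwa [this]

/-- With the inclusion required of a cluster localization, this makes the chart the principal open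
set where the product of the newly frozen variables is invertible. -/
theorem IsNondegenerate.rationalAlgebra_freeze_le (h : s.IsNondegenerate) {u : ClusterSeed N}
    (hsu : s.MutationEquiv u) (S : Finset N)
    (hp : ∏ i ∈ S, u.cluster i ∈ s.rationalAlgebra) :
    (u.freeze S).rationalAlgebra ≤ s.rationalAlgebra.away (∏ i ∈ S, u.cluster i) hp := by
  refine rationalAlgebra_le (fun t ht i => ?_) fun i hi => ?_
  · obtain ⟨r, hr, rfl⟩ := ht.exists_eq_freeze
    exact Subalgebra.le_away (mem_rationalAlgebra (MutationEquiv.cluster_mem (hsu.trans hr) i))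
  · rcases Finset.mem_union.mp (show i ∈ u.quiver.frozen ∪ S from hi) with hi | hi
    · rw [hsu.frozen_eq] at hi
      rw [freeze_cluster, hsu.cluster_eq_of_mem_frozen hi]
      exact Subalgebra.le_away (mem_rationalAlgebra (s.inv_cluster_mem hi))
    · refine Subalgebra.mem_away_of_mul_mem ?_
      rw [freeze_cluster, ← Finset.mul_prod_erase _ _ hi, mul_right_comm,
        mul_inv_cancel₀ ((hsu.isNondegenerate h).cluster_ne_zero i), one_mul]
      exact prod_mem fun l _ => mem_rationalAlgebra (hsu.cluster_mem l)

theorem IsNondegenerate.isRegularRing_of_isLocallyAcyclic (h : s.IsNondegenerate)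
    (hs : s.IsLocallyAcyclic) : IsRegularRing s.rationalAlgebra := by
  obtain ⟨T, -, hT, hcover⟩ := hs
  have hne : ∀ {u}, s.MutationEquiv u → ∀ S : Finset N, ∏ i ∈ S, u.cluster i ≠ 0 :=
    fun hu S => Finset.prod_ne_zero_iff.mpr fun i _ => (hu.isNondegenerate h).cluster_ne_zero i
  have hinv : ∀ (u : ClusterSeed N) (S : Finset N),
      (∏ i ∈ S, u.cluster i)⁻¹ ∈ (u.freeze S).clusterAlgebra := fun u S => by
    rw [← Finset.prod_inv_distrib]
    exact prod_mem fun i hi => (u.freeze S).inv_cluster_mem (Finset.mem_union_right _ hi)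
  have hmem : ∀ {u}, s.MutationEquiv u → ∀ S : Finset N, ∏ i ∈ S, u.cluster i ∈ s.clusterAlgebra :=
    fun hu S => prod_mem fun i _ => hu.cluster_mem i
  refine Subring.isRegularRing_adjoin_of_cover {a | ∃ u, s.MutationEquiv u ∧ ∃ S : Finset N,
    u.freeze S ∈ T ∧ (a : RatFunField N) = ∏ i ∈ S, u.cluster i}
    (Subring.span_eq_top_of_cover fun P => ?_) ?_
  · obtain ⟨t, ht, hloc, hP⟩ := hcover P
    obtain ⟨u, hsu, S, rfl⟩ := hloc.1
    exact ⟨⟨_, hmem hsu S⟩, ⟨u, hsu, S, ht, rfl⟩, hne hsu S, _, hloc.2, hinv u S, hP⟩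
  · rintro a ⟨u, hsu, S, ht, ha⟩
    rw [ha]
    exact ⟨hne hsu S, (u.freeze S).rationalAlgebra, Algebra.adjoin_mono (hT _ ht).1.2,
      mem_rationalAlgebra (hinv u S),
      fun b hb => h.rationalAlgebra_freeze_le hsu S (mem_rationalAlgebra (hmem hsu S)) hb,
      ((hsu.isNondegenerate h).freeze S).isRegularRing_rationalAlgebra (hT _ ht).2⟩

end ClusterSeed

/-! ### Base change to the rational numbers -/

theorem exists_eq_inv_intCast_tmul {A : Type*} [CommRing A] (x : ℚ ⊗[ℤ] A) :
    ∃ n : ℤ, n ≠ 0 ∧ ∃ a : A, x = (n : ℚ)⁻¹ ⊗ₜ a := by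
  have hint : ∀ (q : ℚ) (n : ℤ) (a : A), (q ⊗ₜ[ℤ] (n • a) : ℚ ⊗[ℤ] A) = (n * q) ⊗ₜ a :=
    fun q n a => by rw [← TensorProduct.smul_tmul, zsmul_eq_mul]
  induction x using TensorProduct.induction_on with
  | zero => exact ⟨1, one_ne_zero, 0, by rw [TensorProduct.tmul_zero]⟩
  | tmul q a =>
    refine ⟨q.den, by exact_mod_cast q.den_ne_zero, q.num • a, ?_⟩
    rw [hint, Int.cast_natCast, ← div_eq_mul_inv, Rat.num_div_den]
  | add x y hx hy =>
    obtain ⟨m, hm, a, rfl⟩ := hx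
    obtain ⟨n, hn, b, rfl⟩ := hy
    have hm' : (m : ℚ) ≠ 0 := by exact_mod_cast hm
    have hn' : (n : ℚ) ≠ 0 := by exact_mod_cast hn
    refine ⟨m * n, mul_ne_zero hm hn, n • a + m • b, ?_⟩
    rw [TensorProduct.tmul_add, hint, hint, Int.cast_mul]
    congr 2 <;> field_simp

section BaseChange

variable {K : Type*} [Field K] [Algebra ℚ K] (A : Subring K)

/-- The multiplication map `ℚ ⊗ A → K`. -/
noncomputable def Subring.rationalMul : ℚ ⊗[ℤ] A →ₐ[ℚ] K :=
  Algebra.TensorProduct.lift (Algebra.ofId ℚ K) A.subtype.toIntAlgHom fun _ _ => Commute.all _ _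

theorem Subring.rationalMul_tmul (q : ℚ) (a : A) :
    A.rationalMul (q ⊗ₜ a) = algebraMap ℚ K q * a := rfl

/-- Clearing denominators makes every tensor pure, and a nonzero rational is invertible in `K`. -/
theorem Subring.rationalMul_injective : Function.Injective A.rationalMul := by
  rw [injective_iff_map_eq_zero]
  intro x hx
  obtain ⟨n, hn, a, rfl⟩ := exists_eq_inv_intCast_tmul x
  have hn' : (n : ℚ)⁻¹ ≠ 0 := inv_ne_zero (by exact_mod_cast hn)
  rw [rationalMul_tmul] at hx
  have ha : a = 0 := Subtype.ext ((mul_eq_zero.mp hx).resolve_left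
    ((map_ne_zero (algebraMap ℚ K)).mpr hn'))
  rw [ha, TensorProduct.tmul_zero]

theorem Subring.rationalMul_range : A.rationalMul.range = Algebra.adjoin ℚ (A : Set K) := by
  refine le_antisymm ?_ (Algebra.adjoin_le fun a ha => ⟨1 ⊗ₜ ⟨a, ha⟩, ?_⟩)
  · rintro _ ⟨x, rfl⟩
    induction x using TensorProduct.induction_on with
    | zero => simp
    | tmul q a =>
      change A.rationalMul (q ⊗ₜ a) ∈ _
      rw [rationalMul_tmul, ← Algebra.smul_def]
      exact Subalgebra.smul_mem _ (Algebra.subset_adjoin a.2) _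
    | add x y hx hy =>
      rw [map_add]
      exact add_mem hx hy
  · change A.rationalMul (1 ⊗ₜ ⟨a, ha⟩) = a
    rw [rationalMul_tmul, map_one, one_mul]

/-- `ℚ ⊗ A` is the `ℚ`-algebra generated by `A`. -/
noncomputable def Subring.rationalEquiv : (ℚ ⊗[ℤ] A) ≃ₐ[ℚ] Algebra.adjoin ℚ (A : Set K) :=
  (AlgEquiv.ofInjective A.rationalMul A.rationalMul_injective).trans
    (Subalgebra.equivOfEq _ _ A.rationalMul_range)

end BaseChange

theorem theorem7p5 {N : Type*} [Fintype N] [DecidableEq N] (s : ClusterSeed N)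
    (hs : AlgebraicIndependent ℚ s.cluster)
    (hacyclic : s.IsLocallyAcyclic)
    (hrank : s.quiver.HasFullRank) :
    IsRegularRing (ℚ ⊗[ℤ] s.clusterAlgebra) := by
  have h : s.IsNondegenerate := ⟨hs, hrank.hasIndependentRows⟩
  have := h.isRegularRing_of_isLocallyAcyclic hacyclic
  exact IsRegularRing.of_ringEquiv (R := s.rationalAlgebra)
    s.clusterAlgebra.rationalEquiv.symm.toRingEquiv
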